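/- Theorem 1.1 (Hook plethysms). Let $F$ be an arbitrary field and let $M, d \ge 0$ and $1 \le N \le d+1$ be integers. Let $\mathrm{Sym}^m E$ be the space of homogeneous polynomials of degree $m$ in $F[X,Y]$, on which $\begin{pmatrix} a & b\\ c & e\end{pmatrix} \in \mathrm{SL}_2(F)$ acts by $P(X,Y) \mapsto P(aX+cY, bX+eY)$. For a representation $V$, let $\mathrm{Sym}_n V \subseteq V^{\otimes n}$ be the subspace of tensors invariant under all permutations of the $n$ tensor factors, and, for a basis $(v_i)_i$ of $V$, let $\Delta^{(M+1,1^{N-1})} V \subseteq V^{\otimes N} \otimes V^{\otimes M}$ be the subspace (a subrepresentation, independent of the basis) spanned by the elements $$F_\Delta(t)=\sum_{(c_0,\ldots,c_M)} (v_{c_0}\wedge v_{b_1}\wedge\cdots\wedge v_{b_{N-1}})\otimes v_{c_1}\otimes\cdots\otimes v_{c_M},$$ one for each choice $t$ of basis indices $a_0,\ldots,a_M$ (first row) and $b_1,\ldots,b_{N-1}$ (the rest of the first column), where the sum is over the distinct rearrangements $(c_0,\ldots,c_M)$ of $(a_0,\ldots,a_M)$, and $u_1\wedge\cdots\wedge u_N=\sum_{\sigma\in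 \mathfrak S_N}\mathrm{sgn}(\sigma)\,u_{\sigma^{-1}(1)}\otimes\cdots\otimes u_{\sigma^{-1}(N)}$. Then there is an isomorphism of $\mathrm{SL}_2(F)$-representations $$\Phi:\ \mathrm{Sym}_M \mathrm{Sym}^{N-1}E \otimes \mathrm{Sym}_{M+N} \mathrm{Sym}^{d-N+1}E \;\xrightarrow{\ \cong\ }\; \Delta^{(M+1,1^{N-1})} \mathrm{Sym}^d E .$$ Moreover $\Phi$ can be taken to be the following explicit map. Identify a tensor in $(\mathrm{Sym}^m E)^{\otimes n}$ with a polynomial in $n$ variables by linear extension of $P_1\otimes\cdots\otimes P_n \mapsto \prod_i P_i(x_i,1)$. If $s \in \mathrm{Sym}_M \mathrm{Sym}^{N-1}E$ corresponds to $Q(z_1,\ldots,z_M)$ and $t \in \mathrm{Sym}_{M+N} \mathrm{Sym}^{d-N+1}E$ corresponds to the symmetric polynomial $R(x_1,\ldots,x_N,y_1,\ldots,y_M)$, then $\Phi(s\otimes t)$ corresponds to $$\prod_{1\le i<j\le N}(x_i-x_j)\cdot Q(y_1,\ldots,y_M)\,R(x_1,\ldots,x_N,y_1,\ldots,y_M),$$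 where $x_1,\ldots,x_N$ belong to the first $N$ tensor factors and $y_1,\ldots,y_M$ to the last $M$. -/

import Mathlib

open scoped TensorProduct MatrixGroups

noncomputable section

namespace HookPlethysm

section UpperSymmetricPowers

variable (F : Type*) [Field F]

/-- The algebra endomorphism of `F[X, Y]` (with `X = X 0`, `Y = X 1`) attached to the matrix
`(a b; c d)`: it sends `X ↦ aX + cY` and `Y ↦ bX + dY`. -/
def substHom (A : Matrix (Fin 2) (Fin 2) F) :
    MvPolynomial (Fin 2) F →ₐ[F] MvPolynomial (Fin 2) F :=
  MvPolynomial.aeval fun j : Fin 2 => ∑ i : Fin 2, MvPolynomial.C (A i j) * MvPolynomial.X i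

theorem substHom_one : substHom F 1 = AlgHom.id F _ := by
  ext j : 1
  fin_cases j <;> simp [substHom]

theorem substHom_mul (A B : Matrix (Fin 2) (Fin 2) F) :
    substHom F (A * B) = (substHom F A).comp (substHom F B) := by
  ext j : 1
  simp only [substHom, Matrix.mul_apply, Fin.sum_univ_two, MvPolynomial.aeval_X,
    AlgHom.comp_apply, map_add, map_mul, MvPolynomial.aeval_C, MvPolynomial.algebraMap_eq]
  ring

/-- The action of `SL₂(F)` on `F[X, Y]` by algebra automorphisms. -/
def polyRep : Representation F SL(2, F) (MvPolynomial (Fin 2) F) where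
  toFun g := (substHom F (g : Matrix (Fin 2) (Fin 2) F)).toLinearMap
  map_one' := by
    rw [Matrix.SpecialLinearGroup.coe_one, substHom_one]
    rfl
  map_mul' g h := by
    rw [Matrix.SpecialLinearGroup.coe_mul, substHom_mul]
    rfl

/-- The upper symmetric power `Sym^d E` of the natural representation `E` of `SL₂(F)`:
homogeneous polynomials of degree `d` in `X` and `Y`. -/
def symUpper (d : ℕ) :
    Representation F SL(2, F) (MvPolynomial.homogeneousSubmodule (Fin 2) F d) :=
  Subrepresentation.toRepresentation (ρ := polyRep F)
    { toSubmodule := MvPolynomial.homogeneousSubmodule (Fin 2) F d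
      apply_mem_toSubmodule := fun g p hp => by
        have h := MvPolynomial.IsHomogeneous.aeval (n := 1)
          ((MvPolynomial.mem_homogeneousSubmodule d p).1 hp)
          (fun j : Fin 2 => ∑ i : Fin 2, MvPolynomial.C (g.1 i j) * MvPolynomial.X i)
          (fun j => MvPolynomial.IsHomogeneous.sum _ _ _ fun i _ =>
            (MvPolynomial.isHomogeneous_X F i).C_mul _)
        rw [one_mul] at h
        exact h }

end UpperSymmetricPowers

section Tensors

variable (F : Type*) [Field F] (V : Type*) [AddCommGroup V] [Module F V]

/-- The place permutation action on a tensor power: the factor in position `i` is moved to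
position `σ i`. -/
abbrev placePerm {ι : Type*} (σ : Equiv.Perm ι) :
    (⨂[F] _ : ι, V) ≃ₗ[F] (⨂[F] _ : ι, V) :=
  PiTensorProduct.reindex F (fun _ : ι => V) σ

/-- The lower symmetric power `Sym_n V`: the tensors in `V^{⊗ n}` invariant under all place
permutations. -/
def symLowerSubmodule (n : ℕ) : Submodule F (⨂[F] _ : Fin n, V) where
  carrier := {w | ∀ σ : Equiv.Perm (Fin n), placePerm F V σ w = w}
  zero_mem' σ := map_zero _
  add_mem' hv hw σ := by rw [map_add, hv σ, hw σ]
  smul_mem' c w hw σ := by rw [map_smul, hw σ]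

/-- The boxes of the hook `(M+1, 1^n)`: `Sum.inl` is the first column, with corner `Sum.inl 0`,
and `Sum.inr` is the rest of the first row. -/
abbrev HookBox (M n : ℕ) : Type := Fin (n + 1) ⊕ Fin M

/-- Tensors indexed by the boxes of the hook that are symmetric under all permutations of the
first row. -/
def rowSymmetric (M n : ℕ) : Submodule F (⨂[F] _ : HookBox M n, V) where
  carrier := {w | ∀ σ : Equiv.Perm (HookBox M n),
    (∀ i : Fin (n + 1), i ≠ 0 → σ (Sum.inl i) = Sum.inl i) → placePerm F V σ w = w}
  zero_mem' σ _ := map_zero _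
  add_mem' hv hw σ hσ := by rw [map_add, hv σ hσ, hw σ hσ]
  smul_mem' c w hw σ hσ := by rw [map_smul, hw σ hσ]

/-- Signed sum over all permutations of the first column of the hook. It sends
`u₀ ⊗ ⋯ ⊗ uₙ ⊗ w₁ ⊗ ⋯ ⊗ w_M` to `(u₀ ∧ ⋯ ∧ uₙ) ⊗ w₁ ⊗ ⋯ ⊗ w_M`, where the exterior power is
realised inside the tensor power by `u₀ ∧ ⋯ ∧ uₙ = ∑ sgn(τ) τ · (u₀ ⊗ ⋯ ⊗ uₙ)`. -/
def columnAntisymm (M n : ℕ) :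
    (⨂[F] _ : HookBox M n, V) →ₗ[F] (⨂[F] _ : HookBox M n, V) :=
  ∑ τ : Equiv.Perm (Fin (n + 1)), ((Equiv.Perm.sign τ : ℤ) : F) •
    (placePerm F V (Equiv.sumCongr τ (Equiv.refl (Fin M)))).toLinearMap

/-- The Weyl module `Δ^{(M+1, 1^n)}(V)`, inside `⋀^{n+1} V ⊗ V^{⊗ M} ⊆ V^{⊗ (n+1+M)}`: the image
of the row-symmetric tensors under antisymmetrization of the column. By
`weylHookSubmodule_eq_span` it is spanned by the elements `F_Δ(t)`. -/
def weylHookSubmodule (M n : ℕ) : Submodule F (⨂[F] _ : HookBox M n, V) :=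
  (rowSymmetric F V M n).map (columnAntisymm F V M n)

end Tensors

section Spanning

variable {F : Type*} [Field F] {V : Type*} [AddCommGroup V] [Module F V]
variable {κ : Type*}

/-- The filling of the hook with first row `c` and the remaining column entries `b`. -/
def hookFill {M n : ℕ} (c : Fin (M + 1) → κ) (b : Fin n → κ) : HookBox M n → κ :=
  Sum.elim (Fin.cons (c 0) b) (fun j => c j.succ)

/-- The distinct tuples obtained by permuting `a`. -/
def rearrangements [DecidableEq κ] {m : ℕ} (a : Fin m → κ) : Finset (Fin m → κ) :=
  Finset.univ.image fun σ : Equiv.Perm (Fin m) => a ∘ σ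

variable (F) in
/-- `F_Δ(t) = ∑ (v_{c₀} ∧ v_{b₁} ∧ ⋯ ∧ v_{bₙ}) ⊗ v_{c₁} ⊗ ⋯ ⊗ v_{c_M}`, for `t` the tableau of
shape `(M+1, 1^n)` with first row `a` and lower column entries `b`, summed over the distinct
tuples `c` obtained by permuting `a`. -/
def FDelta [DecidableEq κ] (v : κ → V) {M n : ℕ} (a : Fin (M + 1) → κ) (b : Fin n → κ) :
    ⨂[F] _ : HookBox M n, V :=
  ∑ c ∈ rearrangements a,
    columnAntisymm F V M n (PiTensorProduct.tprod F fun x => v (hookFill c b x))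

theorem columnAntisymm_map {W : Type*} [AddCommGroup W] [Module F W] (f : V →ₗ[F] W) (M n : ℕ)
    (w : ⨂[F] _ : HookBox M n, V) :
    columnAntisymm F W M n (PiTensorProduct.map (fun _ => f) w) =
      PiTensorProduct.map (fun _ => f) (columnAntisymm F V M n w) := by
  simp only [columnAntisymm, LinearMap.sum_apply, LinearMap.smul_apply, map_sum, map_smul]
  refine Finset.sum_congr rfl fun τ _ => ?_
  congr 1
  exact (PiTensorProduct.map_reindex (fun _ => f) _ w).symm

theorem placePerm_hookFill (v : κ → V) {M n : ℕ} (σ : Equiv.Perm (HookBox M n))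
    (c : Fin (M + 1) → κ) (b : Fin n → κ) :
    placePerm F V σ (PiTensorProduct.tprod F fun x => v (hookFill c b x)) =
      PiTensorProduct.tprod F fun x => v (hookFill c b (σ.symm x)) :=
  PiTensorProduct.reindex_tprod σ _

/-- The positions of the first row, followed by the remaining positions of the column. -/
def hookSplit (M n : ℕ) : Fin (M + 1) ⊕ Fin n ≃ HookBox M n where
  toFun := Sum.elim (Fin.cons (Sum.inl 0) Sum.inr) (fun i => Sum.inl i.succ)
  invFun := Sum.elim (Fin.cons (Sum.inl 0) Sum.inr) (fun j => Sum.inl j.succ)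
  left_inv := by
    rintro (i | i)
    · refine Fin.cases ?_ (fun j => ?_) i <;> simp
    · simp
  right_inv := by
    rintro (i | i)
    · refine Fin.cases ?_ (fun j => ?_) i <;> simp
    · simp

theorem hookFill_hookSplit {M n : ℕ} (c : Fin (M + 1) → κ) (b : Fin n → κ)
    (x : Fin (M + 1) ⊕ Fin n) : hookFill c b (hookSplit M n x) = Sum.elim c b x := by
  rcases x with i | i
  · refine Fin.cases ?_ (fun j => ?_) i <;> simp [hookFill, hookSplit]
  · simp [hookFill, hookSplit]

theorem exists_hookFill {M n : ℕ} (p : HookBox M n → κ) :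
    ∃ (c : Fin (M + 1) → κ) (b : Fin n → κ), hookFill c b = p := by
  refine ⟨fun i => p (hookSplit M n (Sum.inl i)), fun i => p (hookSplit M n (Sum.inr i)), ?_⟩
  funext x
  obtain ⟨y, rfl⟩ := (hookSplit M n).surjective x
  rw [hookFill_hookSplit]
  rcases y with y | y <;> rfl

theorem hookFill_injective {M n : ℕ} {c c' : Fin (M + 1) → κ} {b b' : Fin n → κ}
    (h : hookFill c b = hookFill c' b') : c = c' ∧ b = b' := by
  constructor
  · funext i
    have := congrFun h (hookSplit M n (Sum.inl i))
    rwa [hookFill_hookSplit, hookFill_hookSplit] at this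
  · funext i
    have := congrFun h (hookSplit M n (Sum.inr i))
    rwa [hookFill_hookSplit, hookFill_hookSplit] at this

theorem hookFill_rowPerm {M n : ℕ} (σ : Equiv.Perm (HookBox M n))
    (hσ : ∀ i : Fin (n + 1), i ≠ 0 → σ (Sum.inl i) = Sum.inl i) :
    ∃ τ : Equiv.Perm (Fin (M + 1)), ∀ (c : Fin (M + 1) → κ) (b : Fin n → κ) (x),
      hookFill c b (σ x) = hookFill (c ∘ τ) b x := by
  set e := hookSplit M n
  let σ' : Equiv.Perm (Fin (M + 1) ⊕ Fin n) := (e.trans σ).trans e.symm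
  have hr : ∀ i : Fin n, σ' (Sum.inr i) = Sum.inr i := fun i => by
    simp only [σ', Equiv.trans_apply]
    rw [Equiv.symm_apply_eq]
    exact hσ i.succ (Fin.succ_ne_zero i)
  have hl : Set.MapsTo σ' (Set.range Sum.inl) (Set.range Sum.inl) := by
    rintro _ ⟨i, rfl⟩
    rcases h : σ' (Sum.inl i) with j | j
    · exact ⟨j, rfl⟩
    · rw [← hr j] at h
      exact absurd (σ'.injective h) Sum.inl_ne_inr
  obtain ⟨⟨τ, τ'⟩, hτ⟩ := Equiv.Perm.mem_sumCongrHom_range_of_perm_mapsTo_inl hl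
  have hτ' : ∀ y, σ' y = Equiv.sumCongr τ τ' y := fun y => (DFunLike.congr_fun hτ y).symm
  refine ⟨τ, fun c b x => ?_⟩
  obtain ⟨y, rfl⟩ := e.surjective x
  have : σ (e y) = e (σ' y) := by simp [σ']
  rw [this, hookFill_hookSplit, hookFill_hookSplit]
  rcases y with i | i
  · rw [hτ']; rfl
  · rw [hr]; rfl

theorem exists_rowPerm {M n : ℕ} (τ : Equiv.Perm (Fin (M + 1))) :
    ∃ σ : Equiv.Perm (HookBox M n),
      (∀ i : Fin (n + 1), i ≠ 0 → σ (Sum.inl i) = Sum.inl i) ∧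
      ∀ (c : Fin (M + 1) → κ) (b : Fin n → κ) (x),
        hookFill c b (σ x) = hookFill (c ∘ τ) b x := by
  refine ⟨((hookSplit M n).symm.trans (Equiv.sumCongr τ (Equiv.refl _))).trans (hookSplit M n),
    fun i hi => ?_, fun c b x => ?_⟩
  · obtain ⟨j, rfl⟩ := Fin.exists_succ_eq.2 hi
    have : (hookSplit M n).symm (Sum.inl j.succ) = Sum.inr j := by
      rw [Equiv.symm_apply_eq]; rfl
    simp only [Equiv.trans_apply, this]
    rfl
  · obtain ⟨y, rfl⟩ := (hookSplit M n).surjective x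
    simp only [Equiv.trans_apply, Equiv.symm_apply_apply]
    rw [hookFill_hookSplit, hookFill_hookSplit]
    rcases y with i | i <;> rfl

theorem rearrangements_comp [DecidableEq κ] {m : ℕ} (a : Fin m → κ) (τ : Equiv.Perm (Fin m)) :
    rearrangements (a ∘ τ) = rearrangements a := by
  ext c
  simp only [rearrangements, Finset.mem_image, Finset.mem_univ, true_and]
  constructor
  · rintro ⟨σ, rfl⟩
    exact ⟨τ * σ, rfl⟩
  · rintro ⟨σ, rfl⟩
    refine ⟨τ⁻¹ * σ, ?_⟩
    funext i
    simp

theorem mem_rearrangements [DecidableEq κ] {m : ℕ} (a : Fin m → κ) : a ∈ rearrangements a :=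
  Finset.mem_image.2 ⟨1, Finset.mem_univ _, rfl⟩

variable (F) in
/-- The Weyl module of a hook is spanned by the `F_Δ(t)`, for any basis of `V`. -/
theorem weylHookSubmodule_eq_span [Fintype κ] [DecidableEq κ] (v : Module.Basis κ F V)
    (M n : ℕ) :
    weylHookSubmodule F V M n = Submodule.span F (Set.range
      fun t : (Fin (M + 1) → κ) × (Fin n → κ) => FDelta F v t.1 t.2) := by
  let T : (Fin (M + 1) → κ) → (Fin n → κ) → ⨂[F] _ : HookBox M n, V := fun c b =>
    PiTensorProduct.tprod F fun x => v (hookFill c b x)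
  have key : rowSymmetric F V M n = Submodule.span F (Set.range
      fun t : (Fin (M + 1) → κ) × (Fin n → κ) => ∑ c ∈ rearrangements t.1, T c t.2) := by
    apply le_antisymm
    · intro w hw
      let B := Basis.piTensorProduct (fun _ : HookBox M n => v)
      let g : (Fin (M + 1) → κ) → (Fin n → κ) → F := fun a b => B.repr w (hookFill a b)
      have hTB : ∀ a b, T a b = B (hookFill a b) := fun a b => by
        simp [T, B]
      have hg : ∀ a b (τ : Equiv.Perm (Fin (M + 1))), g (a ∘ τ) b = g a b := by
        intro a b τ
        obtain ⟨σ, hσ, hf⟩ := exists_rowPerm (κ := κ) (M := M) (n := n) τ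
        have hs : hookFill (a ∘ τ) b = hookFill a b ∘ σ := funext fun x => (hf a b x).symm
        have hB : ∀ (u : ⨂[F] _ : HookBox M n, V) (p : HookBox M n → κ),
            B.repr (placePerm F V σ u) p = B.repr u (p ∘ σ) := by
          intro u p
          have hlin : (Finsupp.lapply p) ∘ₗ B.repr.toLinearMap ∘ₗ
              (placePerm F V σ).toLinearMap =
              (Finsupp.lapply (p ∘ σ)) ∘ₗ B.repr.toLinearMap := by
            refine B.ext fun q => ?_
            have h1 : placePerm F V σ (B q) = B (q ∘ σ.symm) := by
              simp only [B, Basis.piTensorProduct_apply]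
              exact PiTensorProduct.reindex_tprod σ _
            simp only [LinearMap.comp_apply, LinearEquiv.coe_coe, h1, Module.Basis.repr_self,
              Finsupp.lapply_apply, Finsupp.single_apply]
            congr 1
            exact propext (Equiv.comp_symm_eq σ p q)
          exact LinearMap.congr_fun hlin u
        have := hB w (hookFill a b)
        rw [hw σ hσ] at this
        simp only [g]
        rw [hs, ← this]
      have hw' : w = ∑ b, ∑ a, g a b • T a b := by
        rw [← Finset.sum_product', Finset.univ_product_univ]
        conv_lhs => rw [← B.sum_repr w]
        symm
        refine Fintype.sum_bijective
          (fun t : (Fin n → κ) × (Fin (M + 1) → κ) => hookFill t.2 t.1) ⟨?_, ?_⟩ _ _ ?_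
        · rintro ⟨b, a⟩ ⟨b', a'⟩ h
          obtain ⟨h1, h2⟩ := hookFill_injective h
          exact Prod.ext h2 h1
        · intro p
          obtain ⟨c, b, h⟩ := exists_hookFill p
          exact ⟨(b, c), h⟩
        · rintro ⟨b, a⟩
          simp only [g, hTB]
      rw [hw']
      refine Submodule.sum_mem _ fun b _ => ?_
      rw [← Finset.sum_fiberwise_of_maps_to (s := Finset.univ)
        (t := Finset.univ.image (rearrangements (κ := κ) (m := M + 1)))
        (g := rearrangements) (fun a _ => Finset.mem_image_of_mem _ (Finset.mem_univ a))]
      refine Submodule.sum_mem _ fun O hO => ?_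
      obtain ⟨a, -, rfl⟩ := Finset.mem_image.1 hO
      have hfib : (Finset.univ.filter fun c : Fin (M + 1) → κ =>
          rearrangements c = rearrangements a) = rearrangements a := by
        ext c
        simp only [Finset.mem_filter, Finset.mem_univ, true_and]
        constructor
        · intro h
          rw [← h]
          exact mem_rearrangements c
        · intro h
          obtain ⟨τ, -, rfl⟩ := Finset.mem_image.1 h
          exact rearrangements_comp a τ
      rw [hfib]
      have : ∑ c ∈ rearrangements a, g c b • T c b =
          g a b • ∑ c ∈ rearrangements a, T c b := by
        rw [Finset.smul_sum]
        refine Finset.sum_congr rfl fun c hc => ?_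
        obtain ⟨τ, -, rfl⟩ := Finset.mem_image.1 hc
        rw [hg]
      rw [this]
      exact Submodule.smul_mem _ _ (Submodule.subset_span ⟨(a, b), rfl⟩)
    · rw [Submodule.span_le]
      rintro _ ⟨⟨a, b⟩, rfl⟩ σ hσ
      simp only [map_sum, T]
      have hσ' : ∀ i : Fin (n + 1), i ≠ 0 → σ.symm (Sum.inl i) = Sum.inl i := fun i hi => by
        rw [Equiv.symm_apply_eq, hσ i hi]
      obtain ⟨τ, hτ⟩ := hookFill_rowPerm (κ := κ) σ.symm hσ'
      simp only [placePerm_hookFill, hτ]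
      refine Finset.sum_bij (fun c _ => c ∘ τ) ?_ ?_ ?_ ?_
      · intro c hc
        obtain ⟨ρ, -, rfl⟩ := Finset.mem_image.1 hc
        exact Finset.mem_image.2 ⟨ρ * τ, Finset.mem_univ _, rfl⟩
      · intro c _ c' _ h
        exact τ.surjective.injective_comp_right h
      · intro c hc
        obtain ⟨ρ, -, rfl⟩ := Finset.mem_image.1 hc
        refine ⟨a ∘ (ρ * τ⁻¹ : Equiv.Perm _), Finset.mem_image.2 ⟨_, Finset.mem_univ _, rfl⟩, ?_⟩
        funext i
        simp
      · intro c _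
        rfl
  rw [weylHookSubmodule, key, Submodule.map_span, ← Set.range_comp]
  congr 2
  funext t
  simp only [Function.comp_apply, map_sum, FDelta, T]

end Spanning

section Representations

variable {F : Type*} [Field F] {G : Type*} [Monoid G] {V : Type*} [AddCommGroup V] [Module F V]

/-- The diagonal action of `G` on a tensor power. -/
def tensorRep (ι : Type*) (ρ : Representation F G V) : Representation F G (⨂[F] _ : ι, V) where
  toFun g := PiTensorProduct.map fun _ => ρ g
  map_one' := by
    simp only [map_one]
    exact PiTensorProduct.map_one
  map_mul' g h := by
    simp only [map_mul]
    exact PiTensorProduct.map_mul _ _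

/-- The representation of `G` on the lower symmetric power `Sym_n V`. -/
def symLower (n : ℕ) (ρ : Representation F G V) :
    Representation F G (symLowerSubmodule F V n) :=
  Subrepresentation.toRepresentation (ρ := tensorRep (Fin n) ρ)
    { toSubmodule := symLowerSubmodule F V n
      apply_mem_toSubmodule := fun g w hw σ =>
        (PiTensorProduct.map_reindex (fun _ => ρ g) σ w).symm.trans (by rw [hw σ]; rfl) }

/-- The representation of `G` on the Weyl module `Δ^{(M+1, 1^n)}(V)`. -/
def weylHook (M n : ℕ) (ρ : Representation F G V) :
    Representation F G (weylHookSubmodule F V M n) :=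
  Subrepresentation.toRepresentation (ρ := tensorRep (HookBox M n) ρ)
    { toSubmodule := weylHookSubmodule F V M n
      apply_mem_toSubmodule := by
        rintro g _ ⟨w, hw, rfl⟩
        refine ⟨tensorRep (HookBox M n) ρ g w, fun σ hσ => ?_, columnAntisymm_map (ρ g) M n w⟩
        exact (PiTensorProduct.map_reindex (fun _ => ρ g) σ w).symm.trans
          (by rw [hw σ hσ]; rfl) }

end Representations

section Polynomials

variable (F : Type*) [Field F]

/-- The polynomial attached to a tensor in `(Sym^d E)^{⊗ ι}`: the linear map sending
`⊗ᵢ Pᵢ(X, Y)` to `∏ᵢ Pᵢ(xᵢ, 1)`. -/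
def tensorToPoly (ι : Type*) [Fintype ι] (d : ℕ) :
    (⨂[F] _ : ι, MvPolynomial.homogeneousSubmodule (Fin 2) F d) →ₗ[F] MvPolynomial ι F :=
  PiTensorProduct.lift
    ((MultilinearMap.mkPiAlgebra F ι (MvPolynomial ι F)).compLinearMap fun i =>
      (MvPolynomial.aeval ![MvPolynomial.X i, 1]).toLinearMap ∘ₗ
        (MvPolynomial.homogeneousSubmodule (Fin 2) F d).subtype)

/-- The Vandermonde determinant `∏_{i < j} (xᵢ - xⱼ)`, in the variables `xᵢ = X (inl i)` attached
to the first column of the hook. -/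
def vandermondePoly (M n : ℕ) : MvPolynomial (HookBox M n) F :=
  ∏ i : Fin (n + 1), ∏ j ∈ Finset.Ioi i,
    (MvPolynomial.X (Sum.inl i) - MvPolynomial.X (Sum.inl j))

end Polynomials

end HookPlethysm

end

open HookPlethysm

/-!
# Hook plethysms

Put `n = N - 1` and `k = d - n`. Multiplying polynomials corresponds to multiplying tensors factor
by factor, so the asserted map is `hookMul`: it sends `s ⊗ t` to the factorwise product of `t`,
spread over the boxes of the hook, with `(X^n ∧ X^(n-1)Y ∧ ⋯ ∧ Y^n) ⊗ s`, the wedge being the tensor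
of the Vandermonde product. Equivariance (`hookMul_tensorRep`) is seen after homogenizing:
`xᵢ - xⱼ` becomes `Xᵢ Yⱼ - Xⱼ Yᵢ`, which is invariant under substitutions of determinant one.

The map lands in the Weyl module (`hookMul_mem_weylHookSubmodule`). Since `t` is invariant under all
place permutations, it suffices to treat `(X^n ∧ ⋯ ∧ Y^n) ⊗ s`, which is the column
antisymmetrization of a row-symmetric tensor obtained by extending `s` to one more box.

It is injective (`hookMul_injective`). Write an element of its kernel as `∑ Q_α ⊗ R_α`, so that
`∑ Q_α(y) R_α(x, y) = 0`. As the `R_α` are symmetric in all `M + N` variables, the relation remains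
true when `y` is replaced by any `M` distinct ones among them. A polynomial of degree at most `n` in
each of `M` variables that vanishes at all `M`-tuples of distinct elements of a set of `M + n` points
is zero (`eq_zero_of_eval_injective`), hence `∑ Q_α(T) R_α = 0` for indeterminates `T`.

It is surjective by a dimension count. The Garnir relations express the coefficients of an element
of the Weyl module through those at fillings whose smallest entry is in the column
(`weyl_eq_zero_of_repr_eq_zero`), so that its dimension is at most the number of semistandard
fillings, which is
`∑_{e ≤ d} C(e, n) C(e + M, M) = C(M + n, M) C(d + M + 1, M + n + 1)`,
the dimension of the source.
-/

namespace HookPlethysm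

noncomputable section

/-! ### Coefficients of elements of the Weyl module -/

section Coefficients

variable {F : Type*} [Field F] {V : Type*} [AddCommGroup V] [Module F V] {κ : Type*}

theorem exists_perm_comp_eq {ι : Type*} [Fintype ι] {p q : ι → κ}
    (h : (Finset.univ : Finset ι).val.map p = (Finset.univ : Finset ι).val.map q) :
    ∃ σ : Equiv.Perm ι, p = q ∘ σ := by
  classical
  have hcard : ∀ c, Fintype.card {i // p i = c} = Fintype.card {i // q i = c} := fun c => by
    have h2 := congrArg (Multiset.count c) h
    rw [Multiset.count_map, Multiset.count_map] at h2
    simp only [Fintype.card_subtype]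
    rw [Finset.card_def, Finset.card_def, Finset.filter_val, Finset.filter_val]
    simpa only [eq_comm] using h2
  refine ⟨Equiv.ofFiberEquiv fun c => Fintype.equivOfCardEq (hcard c), ?_⟩
  funext i
  exact (Equiv.ofFiberEquiv_map _ i).symm

theorem repr_placePerm {ι : Type*} [Finite ι] (v : Module.Basis κ F V) (σ : Equiv.Perm ι)
    (w : ⨂[F] _ : ι, V) (p : ι → κ) :
    (Basis.piTensorProduct fun _ : ι => v).repr (placePerm F V σ w) p =
      (Basis.piTensorProduct fun _ : ι => v).repr w (p ∘ σ) := by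
  classical
  set B := Basis.piTensorProduct fun _ : ι => v
  have hlin : (Finsupp.lapply p) ∘ₗ B.repr.toLinearMap ∘ₗ (placePerm F V σ).toLinearMap =
      (Finsupp.lapply (p ∘ σ)) ∘ₗ B.repr.toLinearMap := by
    refine B.ext fun q => ?_
    have h1 : placePerm F V σ (B q) = B (q ∘ σ.symm) := by
      simp only [B, Basis.piTensorProduct_apply]
      exact PiTensorProduct.reindex_tprod σ _
    simp only [LinearMap.comp_apply, LinearEquiv.coe_coe, h1, Module.Basis.repr_self,
      Finsupp.lapply_apply, Finsupp.single_apply]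
    congr 1
    exact propext (Equiv.comp_symm_eq σ p q)
  exact LinearMap.congr_fun hlin w

theorem repr_columnAntisymm (v : Module.Basis κ F V) {M n : ℕ} (w : ⨂[F] _ : HookBox M n, V)
    (p : HookBox M n → κ) :
    (Basis.piTensorProduct fun _ : HookBox M n => v).repr (columnAntisymm F V M n w) p =
      ∑ τ : Equiv.Perm (Fin (n + 1)), ((Equiv.Perm.sign τ : ℤ) : F) *
        (Basis.piTensorProduct fun _ : HookBox M n => v).repr w
          (p ∘ Equiv.sumCongr τ (Equiv.refl (Fin M))) := by
  simp only [columnAntisymm, LinearMap.sum_apply, LinearMap.smul_apply, map_sum, map_smul,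
    Finsupp.coe_finsetSum, Finset.sum_apply, Finsupp.smul_apply, LinearEquiv.coe_coe,
    repr_placePerm, smul_eq_mul]

/-- A signed sum over a symmetric group vanishes when its summand is invariant under right
multiplication by a transposition. -/
theorem sum_sign_mul_eq_zero {α : Type*} [Fintype α] [DecidableEq α] (f : Equiv.Perm α → F)
    {i j : α} (hij : i ≠ j) (hf : ∀ τ, f (τ * Equiv.swap i j) = f τ) :
    ∑ τ : Equiv.Perm α, ((Equiv.Perm.sign τ : ℤ) : F) * f τ = 0 := by
  refine Finset.sum_involution (fun τ _ => τ * Equiv.swap i j) ?_ ?_ ?_ ?_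
  · intro τ _
    rw [hf, map_mul, Equiv.Perm.sign_swap hij]
    simp
  · intro τ _ _ h
    have := mul_eq_left.1 h
    exact hij (Equiv.swap_eq_one_iff.1 this)
  · intro τ _
    exact Finset.mem_univ _
  · intro τ _
    simp [mul_assoc]

section Weyl

variable (v : Module.Basis κ F V) {M n : ℕ} {w : ⨂[F] _ : HookBox M n, V}

theorem repr_weyl_column (hw : w ∈ weylHookSubmodule F V M n) (p : HookBox M n → κ)
    (τ : Equiv.Perm (Fin (n + 1))) :
    (Basis.piTensorProduct fun _ : HookBox M n => v).repr w
        (p ∘ Equiv.sumCongr τ (Equiv.refl (Fin M))) =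
      ((Equiv.Perm.sign τ : ℤ) : F) *
        (Basis.piTensorProduct fun _ : HookBox M n => v).repr w p := by
  obtain ⟨f, -, rfl⟩ := hw
  rw [repr_columnAntisymm, repr_columnAntisymm, Finset.mul_sum]
  refine Fintype.sum_equiv (Equiv.mulLeft τ) _ _ fun τ' => ?_
  have h : p ∘ Equiv.sumCongr τ (Equiv.refl (Fin M)) ∘ Equiv.sumCongr τ' (Equiv.refl (Fin M)) =
      p ∘ Equiv.sumCongr (τ * τ') (Equiv.refl (Fin M)) := by
    funext x
    rcases x with x | x <;> rfl
  have hs : ((Equiv.Perm.sign τ : ℤ) : F) * ((Equiv.Perm.sign τ : ℤ) : F) = 1 := by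
    rw [← Int.cast_mul, ← Units.val_mul, Int.units_mul_self]
    simp
  rw [Equiv.coe_mulLeft, Function.comp_assoc, h, map_mul, Units.val_mul, Int.cast_mul, ← mul_assoc,
    ← mul_assoc, hs, one_mul]

theorem repr_weyl_eq_zero_of_not_injective (hw : w ∈ weylHookSubmodule F V M n)
    (p : HookBox M n → κ) {i j : Fin (n + 1)} (hij : i ≠ j)
    (hp : p (Sum.inl i) = p (Sum.inl j)) :
    (Basis.piTensorProduct fun _ : HookBox M n => v).repr w p = 0 := by
  obtain ⟨f, -, rfl⟩ := hw
  rw [repr_columnAntisymm]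
  rw [← Equiv.sum_comp (Equiv.inv (Equiv.Perm (Fin (n + 1))))]
  simp only [Equiv.inv_apply, Equiv.Perm.sign_inv]
  refine sum_sign_mul_eq_zero _ hij fun τ => ?_
  congr 1
  funext x
  rcases x with x | x
  · simp only [Function.comp_apply, Equiv.sumCongr_apply, Sum.map_inl, mul_inv_rev,
      Equiv.swap_inv, Equiv.Perm.mul_apply]
    by_cases h1 : τ⁻¹ x = i
    · rw [h1, Equiv.swap_apply_left, hp]
    · by_cases h2 : τ⁻¹ x = j
      · rw [h2, Equiv.swap_apply_right, hp]
      · rw [Equiv.swap_apply_of_ne_of_ne h1 h2]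
  · rfl

theorem repr_weyl_row (hw : w ∈ weylHookSubmodule F V M n) (p : HookBox M n → κ)
    (ρ : Equiv.Perm (Fin M)) :
    (Basis.piTensorProduct fun _ : HookBox M n => v).repr w
        (p ∘ Equiv.sumCongr (Equiv.refl (Fin (n + 1))) ρ) =
      (Basis.piTensorProduct fun _ : HookBox M n => v).repr w p := by
  obtain ⟨f, hf, rfl⟩ := hw
  rw [repr_columnAntisymm, repr_columnAntisymm]
  refine Finset.sum_congr rfl fun τ _ => ?_
  have h : (p ∘ Equiv.sumCongr (Equiv.refl (Fin (n + 1))) ρ) ∘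
      Equiv.sumCongr τ (Equiv.refl (Fin M)) =
      (p ∘ Equiv.sumCongr τ (Equiv.refl (Fin M))) ∘
        Equiv.sumCongr (Equiv.refl (Fin (n + 1))) ρ := by
    funext x
    rcases x with x | x <;> rfl
  rw [h, ← repr_placePerm, hf _ fun i _ => rfl]

/-- The Garnir relation between the column and a box `j` of the row: the signed sum of an element
of the Weyl module over the cosets of the column permutations in the permutations of the column
together with `j` is zero. -/
theorem repr_weyl_garnir (hw : w ∈ weylHookSubmodule F V M n) (p : HookBox M n → κ) (j : Fin M) :
    (Basis.piTensorProduct fun _ : HookBox M n => v).repr w p =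
      ∑ i : Fin (n + 1), (Basis.piTensorProduct fun _ : HookBox M n => v).repr w
        (p ∘ Equiv.swap (Sum.inl i) (Sum.inr j)) := by
  obtain ⟨f, hf, rfl⟩ := hw
  simp only [repr_columnAntisymm]
  set c := (Basis.piTensorProduct fun _ : HookBox M n => v).repr f
  let T : Equiv.Perm (Fin (n + 1)) → Equiv.Perm (HookBox M n) := fun τ =>
    Equiv.sumCongr τ (Equiv.refl (Fin M))
  let s : Fin (n + 1) → Equiv.Perm (HookBox M n) := fun i => Equiv.swap (Sum.inl i) (Sum.inr j)
  have hT : ∀ τ i, (s (τ i)) * T τ = T τ * s i := fun τ i =>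
    (Equiv.mul_swap_eq_swap_mul (T τ) (Sum.inl i) (Sum.inr j)).symm
  have hc : ∀ q : HookBox M n → κ, c (q ∘ s 0) = c q := fun q => by
    have := hf (s 0) fun i hi => Equiv.swap_apply_of_ne_of_ne
      (fun h => hi (Sum.inl_injective h)) Sum.inl_ne_inr
    rw [← repr_placePerm, this]
  -- Pull the exchange `s i` through `τ`, so that it acts first.
  have hswap : ∑ i, ∑ τ : Equiv.Perm (Fin (n + 1)), ((Equiv.Perm.sign τ : ℤ) : F) *
      c ((p ∘ s i) ∘ T τ) =
      ∑ k, ∑ τ : Equiv.Perm (Fin (n + 1)), ((Equiv.Perm.sign τ : ℤ) : F) *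
        c (p ∘ (T τ * s k : Equiv.Perm (HookBox M n))) := by
    rw [Finset.sum_comm, Finset.sum_comm (γ := Fin (n + 1))]
    refine Finset.sum_congr rfl fun τ _ => ?_
    symm
    refine Fintype.sum_equiv τ _ _ fun k => ?_
    rw [← hT]
    rfl
  refine Eq.trans ?_ hswap.symm
  rw [Finset.sum_eq_single (0 : Fin (n + 1))]
  · refine Finset.sum_congr rfl fun τ _ => ?_
    rw [Equiv.Perm.coe_mul, ← Function.comp_assoc, hc]
  · intro k _ hk
    refine sum_sign_mul_eq_zero _ hk.symm fun τ => ?_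
    -- `T (swap 0 k) * s k = s k * s 0`, and `s 0` lies in the row.
    have h1 : T (τ * Equiv.swap 0 k) * s k = T τ * s k * s 0 := by
      have h2 : T (τ * Equiv.swap 0 k) = T τ * T (Equiv.swap 0 k) := by
        ext x
        rcases x with x | x <;> rfl
      have h3 := hT (Equiv.swap 0 k) 0
      rw [Equiv.swap_apply_left] at h3
      rw [h2, mul_assoc, mul_assoc]
      congr 1
      have h4 : T (Equiv.swap 0 k) = Equiv.swap (Sum.inl 0) (Sum.inl k) := by
        ext x
        rcases x with x | x
        · simp only [T, Equiv.sumCongr_apply, Sum.map_inl, Equiv.swap_apply_def,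
            Sum.inl.injEq]
          split_ifs <;> rfl
        · simp [T, Equiv.swap_apply_of_ne_of_ne]
      have h5 := Equiv.mul_swap_eq_swap_mul (s k) (Sum.inl 0) (Sum.inr j)
      rw [show s k (Sum.inr j) = Sum.inl k from Equiv.swap_apply_right _ _,
        show s k (Sum.inl 0) = Sum.inl 0 from Equiv.swap_apply_of_ne_of_ne
          (fun h => hk (Sum.inl_injective h).symm) Sum.inl_ne_inr] at h5
      rw [h4]
      exact h5.symm
    rw [h1, Equiv.Perm.coe_mul (T τ * s k), ← Function.comp_assoc, hc]
  · simp

/-- An element of the Weyl module is determined by its coefficients at the fillings whose smallest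
entry lies in the column. -/
theorem weyl_eq_zero_of_repr_eq_zero [LinearOrder κ] (hw : w ∈ weylHookSubmodule F V M n)
    (h : ∀ p : HookBox M n → κ, (p ∘ Sum.inl).Injective → (∃ i, ∀ x, p (Sum.inl i) ≤ p x) →
      (Basis.piTensorProduct fun _ : HookBox M n => v).repr w p = 0) : w = 0 := by
  have h' : ∀ p : HookBox M n → κ, (∃ i, ∀ x, p (Sum.inl i) ≤ p x) →
      (Basis.piTensorProduct fun _ : HookBox M n => v).repr w p = 0 := by
    intro p hp
    by_cases hi : (p ∘ Sum.inl).Injective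
    · exact h p hi hp
    · simp only [Function.Injective, not_forall] at hi
      obtain ⟨i, j, hij, hne⟩ := hi
      exact repr_weyl_eq_zero_of_not_injective v hw p hne hij
  refine (Basis.piTensorProduct fun _ : HookBox M n => v).ext_elem fun p => ?_
  rw [map_zero, Finsupp.zero_apply]
  obtain ⟨x, hx⟩ := Finite.exists_min p
  rcases x with i | j
  · exact h' p ⟨i, hx⟩
  · rw [repr_weyl_garnir v hw p j]
    refine Finset.sum_eq_zero fun i _ => h' _ ⟨i, fun x => ?_⟩
    simp only [Function.comp_apply, Equiv.swap_apply_left]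
    exact hx _

end Weyl

end Coefficients

/-! ### Dimension bounds -/

section Dimensions

variable {F : Type*} [Field F] {V : Type*} [AddCommGroup V] [Module F V] {κ : Type*}

theorem exists_map_univ_eq (s : Multiset κ) {n : ℕ} (h : s.card = n) :
    ∃ q : Fin n → κ, (Finset.univ : Finset (Fin n)).val.map q = s := by
  have key : ∃ q : Fin s.toList.length → κ,
      (Finset.univ : Finset (Fin s.toList.length)).val.map q = (s.toList : Multiset κ) :=
    ⟨s.toList.get, by rw [Fin.univ_val_map, List.ofFn_get]⟩
  rwa [Multiset.length_toList, h, Multiset.coe_toList] at key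

theorem repr_symLower_congr (v : Module.Basis κ F V) {n : ℕ} {w : ⨂[F] _ : Fin n, V}
    (hw : w ∈ symLowerSubmodule F V n) {p q : Fin n → κ}
    (h : (Finset.univ : Finset (Fin n)).val.map p = (Finset.univ : Finset (Fin n)).val.map q) :
    (Basis.piTensorProduct fun _ : Fin n => v).repr w p =
      (Basis.piTensorProduct fun _ : Fin n => v).repr w q := by
  obtain ⟨σ, rfl⟩ := exists_perm_comp_eq h
  rw [← repr_placePerm, hw σ]

/-- Monomial symmetric tensors are linearly independent, whence the lower bound for the dimension
of the symmetric tensors. -/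
theorem multichoose_le_finrank_symLower [Fintype κ] (v : Module.Basis κ F V) (n : ℕ) :
    (Fintype.card κ).multichoose n ≤ Module.finrank F (symLowerSubmodule F V n) := by
  classical
  have : FiniteDimensional F V := v.finiteDimensional_of_finite
  let B := Basis.piTensorProduct fun _ : Fin n => v
  let sym : (Fin n → κ) → Sym κ n := fun p =>
    ⟨(Finset.univ : Finset (Fin n)).val.map p, by simp⟩
  have hsym : ∀ (p : Fin n → κ) (σ : Equiv.Perm (Fin n)), sym (p ∘ σ) = sym p := fun p σ => by
    apply Subtype.ext
    change Multiset.map (p ∘ σ) (Finset.univ : Finset (Fin n)).val =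
      Multiset.map p (Finset.univ : Finset (Fin n)).val
    rw [← Multiset.map_map, Multiset.map_univ_val_equiv]
  let L : (Sym κ n → F) →ₗ[F] ⨂[F] _ : Fin n, V :=
    B.equivFun.symm.toLinearMap ∘ₗ LinearMap.funLeft F F sym
  have hL : ∀ g p, B.repr (L g) p = g (sym p) := fun g p => by
    rw [← Module.Basis.equivFun_apply]
    change B.equivFun (B.equivFun.symm (g ∘ sym)) p = _
    rw [LinearEquiv.apply_symm_apply]
    rfl
  have hmem : ∀ g, L g ∈ symLowerSubmodule F V n := fun g σ =>
    B.ext_elem fun p => by rw [repr_placePerm, hL, hL, hsym]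
  have hinj : Function.Injective (L.codRestrict _ hmem) := fun g g' h => by
    funext s
    obtain ⟨p, hp⟩ := exists_map_univ_eq s.1 s.2
    have h1 : L g = L g' := congrArg Subtype.val h
    have h2 := congrArg (fun w => B.repr w p) h1
    simp only [hL] at h2
    rwa [show sym p = s from Subtype.ext hp] at h2
  have := LinearMap.finrank_le_finrank_of_injective hinj
  rwa [Module.finrank_fintype_fun_eq_card, Sym.card_sym_eq_multichoose] at this

/-- The Weyl module has dimension at most the number of semistandard fillings of the hook, listed
by the corner entry `m`, the set of the other column entries and the multiset of the other row
entries. -/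
theorem finrank_weylHook_le [Fintype κ] [LinearOrder κ] [LocallyFiniteOrderTop κ]
    (v : Module.Basis κ F V) (M n : ℕ) :
    Module.finrank F (weylHookSubmodule F V M n) ≤
      ∑ m : κ, (Finset.Ioi m).card.choose n * (Finset.Ici m).card.multichoose M := by
  classical
  have : FiniteDimensional F V := v.finiteDimensional_of_finite
  let B := Basis.piTensorProduct fun _ : HookBox M n => v
  let T := Σ m : κ, (Finset.powersetCard n (Finset.Ioi m)) × Sym (Finset.Ici m) M
  have hex : ∀ t : T, ∃ p : HookBox M n → κ,
      (Finset.univ : Finset (Fin (n + 1))).val.map (p ∘ Sum.inl) = t.1 ::ₘ t.2.1.1.val ∧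
      (Finset.univ : Finset (Fin M)).val.map (p ∘ Sum.inr) = t.2.2.1.map Subtype.val := by
    intro t
    obtain ⟨p, hp⟩ := exists_map_univ_eq (n := n + 1) (t.1 ::ₘ t.2.1.1.val) (by
      rw [Multiset.card_cons, ← Finset.card_def, (Finset.mem_powersetCard.1 t.2.1.2).2])
    obtain ⟨q, hq⟩ := exists_map_univ_eq (n := M) (t.2.2.1.map Subtype.val) (by
      rw [Multiset.card_map]
      exact t.2.2.2)
    exact ⟨Sum.elim p q, by simpa using hp, by simpa using hq⟩
  choose P hP1 hP2 using hex
  let L : weylHookSubmodule F V M n →ₗ[F] (T → F) :=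
    LinearMap.pi fun t => (Finsupp.lapply (P t)) ∘ₗ B.repr.toLinearMap ∘ₗ Submodule.subtype _
  have hinj : Function.Injective L := by
    rw [injective_iff_map_eq_zero]
    intro w hw0
    apply Subtype.ext
    refine weyl_eq_zero_of_repr_eq_zero v w.2 fun p hp hmin => ?_
    obtain ⟨i, hi⟩ := hmin
    let b : Finset κ := (Finset.univ.erase i).image (p ∘ Sum.inl)
    have hb : b ∈ Finset.powersetCard n (Finset.Ioi (p (Sum.inl i))) := by
      rw [Finset.mem_powersetCard]
      constructor
      · intro y hy
        obtain ⟨j, hj, rfl⟩ := Finset.mem_image.1 hy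
        exact Finset.mem_Ioi.2 (lt_of_le_of_ne (hi _)
          fun h => (Finset.mem_erase.1 hj).1 (hp h).symm)
      · rw [Finset.card_image_of_injective _ hp, Finset.card_erase_of_mem (Finset.mem_univ i)]
        simp
    let a : Sym (Finset.Ici (p (Sum.inl i))) M :=
      ⟨(Finset.univ : Finset (Fin M)).val.map
        fun j => ⟨p (Sum.inr j), Finset.mem_Ici.2 (hi _)⟩, by simp⟩
    let t : T := ⟨p (Sum.inl i), ⟨b, hb⟩, a⟩
    obtain ⟨τ, hτ⟩ := exists_perm_comp_eq (p := p ∘ Sum.inl) (q := P t ∘ Sum.inl) (by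
      rw [hP1, ← Multiset.cons_erase (Finset.mem_univ_val i), Multiset.map_cons]
      congr 1
      rw [Finset.image_val_of_injOn hp.injOn, Finset.erase_val])
    obtain ⟨ρ, hρ⟩ := exists_perm_comp_eq (p := p ∘ Sum.inr) (q := P t ∘ Sum.inr) (by
      rw [hP2, Multiset.map_map]
      rfl)
    have hpt : p = (P t ∘ Equiv.sumCongr (Equiv.refl (Fin (n + 1))) ρ) ∘
        Equiv.sumCongr τ (Equiv.refl (Fin M)) := by
      funext x
      rcases x with x | x
      · exact congrFun hτ x
      · exact congrFun hρ x
    rw [hpt, repr_weyl_column v w.2, repr_weyl_row v w.2]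
    have h0 : B.repr w.1 (P t) = 0 := congrFun hw0 t
    rw [h0, mul_zero]
  have := LinearMap.finrank_le_finrank_of_injective hinj
  rw [Module.finrank_fintype_fun_eq_card, Fintype.card_sigma] at this
  refine this.trans (Finset.sum_le_sum fun m _ => ?_)
  rw [Fintype.card_prod, Sym.card_sym_eq_multichoose, Fintype.card_coe, Fintype.card_coe,
    Finset.card_powersetCard]

theorem sum_choose_mul_choose (M n d : ℕ) :
    ∑ e ∈ Finset.range (d + 1), e.choose n * (e + M).choose M =
      (M + n).choose M * (d + M + 1).choose (M + n + 1) := by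
  have key : ∀ e, e.choose n * (e + M).choose M = (M + n).choose M * (e + M).choose (M + n) := by
    intro e
    rcases le_or_gt n e with h | h
    · have := Nat.choose_mul (n := e + M) (k := M + n) (s := M)
        (Nat.le_add_right M n)
      rw [Nat.add_sub_cancel, Nat.add_sub_cancel_left] at this
      linarith
    · rw [Nat.choose_eq_zero_of_lt h, Nat.choose_eq_zero_of_lt (by omega : e + M < M + n)]
      simp
  induction d with
  | zero =>
    rw [Finset.sum_range_one, key]
    rcases n with _ | n
    · simp
    · rw [Nat.choose_eq_zero_of_lt (by omega : 0 + M < M + (n + 1)),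
        Nat.choose_eq_zero_of_lt (by omega : 0 + M + 1 < M + (n + 1) + 1)]
  | succ d ih =>
    rw [Finset.sum_range_succ, ih, key, ← Nat.mul_add,
      Nat.choose_succ_succ (d + 1 + M), show d + 1 + M = d + M + 1 by ring]
    ring

/-- The dimension count: for `d = n + k` the Weyl module is no larger than the tensor product of
the two spaces of symmetric tensors. -/
theorem finrank_weylHook_le_mul {W U : Type*} [AddCommGroup W] [Module F W] [AddCommGroup U]
    [Module F U] (M n k d : ℕ) (hd : n + k = d) (v : Module.Basis (Fin (d + 1)) F V)
    (w : Module.Basis (Fin (n + 1)) F W) (u : Module.Basis (Fin (k + 1)) F U) :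
    Module.finrank F (weylHookSubmodule F V M n) ≤
      Module.finrank F (symLowerSubmodule F W M) *
        Module.finrank F (symLowerSubmodule F U (M + n + 1)) := by
  refine (finrank_weylHook_le v M n).trans ?_
  refine le_trans (le_of_eq ?_) (Nat.mul_le_mul (multichoose_le_finrank_symLower w M)
    (multichoose_le_finrank_symLower u (M + n + 1)))
  simp only [Fin.card_Ioi, Fin.card_Ici, Fintype.card_fin, Nat.multichoose_eq]
  rw [Fin.sum_univ_eq_sum_range
    (fun m => (d + 1 - 1 - m).choose n * (d + 1 - m + M - 1).choose M) (d + 1),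
    ← Finset.sum_range_reflect]
  have : ∀ j ∈ Finset.range (d + 1),
      (d + 1 - 1 - (d + 1 - 1 - j)).choose n * (d + 1 - (d + 1 - 1 - j) + M - 1).choose M =
        j.choose n * (j + M).choose M := by
    intro j hj
    have := Finset.mem_range.1 hj
    congr 2 <;> omega
  rw [Finset.sum_congr rfl this, sum_choose_mul_choose]
  congr 2 <;> omega

variable (F V) in
theorem finite_symLowerSubmodule [Module.Finite F V] (n : ℕ) :
    Module.Finite F (symLowerSubmodule F V n) := inferInstance

variable (F V) in
theorem finite_weylHookSubmodule [Module.Finite F V] (M n : ℕ) :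
    Module.Finite F (weylHookSubmodule F V M n) := inferInstance

end Dimensions

/-! ### Tensors of binary forms as polynomials -/

section PolynomialModel

open MvPolynomial

local notation "Forms" => MvPolynomial.homogeneousSubmodule (Fin 2)

variable (F : Type*) [Field F]

/-- Exponents of binary monomials of degree `d`, listed by the exponent of `X 0`. -/
def binaryExponentEquiv (d : ℕ) : {e : Fin 2 →₀ ℕ // e.degree = d} ≃ Fin (d + 1) where
  toFun e := ⟨e.1 0, by
    have := e.2
    rw [Finsupp.degree_eq_sum, Fin.sum_univ_two] at this
    omega⟩
  invFun k := ⟨Finsupp.equivFunOnFinite.symm ![k.1, d - k.1], by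
    rw [Finsupp.degree_eq_sum, Fin.sum_univ_two]
    simp
    omega⟩
  left_inv e := by
    apply Subtype.ext
    have := e.2
    rw [Finsupp.degree_eq_sum, Fin.sum_univ_two] at this
    ext i
    fin_cases i
    · simp
    · simp
      omega
  right_inv k := by simp

theorem restrictSupport_degree_eq (d : ℕ) :
    restrictSupport F {e : Fin 2 →₀ ℕ | e.degree = d} = Forms F d :=
  (homogeneousSubmodule_eq_finsupp_supported (Fin 2) F d).symm

theorem coe_basisRestrictSupport {σ : Type*} (s : Set (σ →₀ ℕ)) (e : s) :
    (basisRestrictSupport F s e : MvPolynomial σ F) = monomial e.1 1 := by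
  classical
  have hmem : monomial e.1 (1 : F) ∈ restrictSupport F s := by
    rw [mem_restrictSupport_iff]
    exact fun x hx => (Finset.mem_singleton.1 (support_monomial_subset hx)).symm ▸ e.2
  suffices basisRestrictSupport F s e = ⟨monomial e.1 1, hmem⟩ by rw [this]
  apply (basisRestrictSupport F s).repr.injective
  rw [Module.Basis.repr_self]
  ext x
  have h : (basisRestrictSupport F s).repr ⟨monomial e.1 1, hmem⟩ x = coeff x.1 (monomial e.1 1) :=
    rfl
  rw [h, coeff_monomial, Finsupp.single_apply]
  simp only [Subtype.ext_iff]

/-- The basis `X ^ k * Y ^ (d - k)`, for `0 ≤ k ≤ d`, of the binary forms of degree `d`. -/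
def binaryBasis (d : ℕ) : Module.Basis (Fin (d + 1)) F (Forms F d) :=
  ((basisRestrictSupport F {e : Fin 2 →₀ ℕ | e.degree = d}).map
    (LinearEquiv.ofEq _ _ (restrictSupport_degree_eq F d))).reindex (binaryExponentEquiv d)

theorem coe_binaryBasis (d : ℕ) (k : Fin (d + 1)) :
    (binaryBasis F d k : MvPolynomial (Fin 2) F) = X 0 ^ k.1 * X 1 ^ (d - k.1) := by
  rw [binaryBasis, Module.Basis.reindex_apply, Module.Basis.map_apply, LinearEquiv.coe_ofEq_apply,
    coe_basisRestrictSupport, monomial_eq, Finsupp.prod_fintype _ _ (by simp), Fin.prod_univ_two]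
  simp [binaryExponentEquiv]

variable (ι : Type*) [Fintype ι]

/-- The homogeneous version of `tensorToPoly`: the linear map sending `⊗ᵢ Pᵢ(X, Y)` to
`∏ᵢ Pᵢ(Xᵢ, Yᵢ)`, where `Xᵢ = X (i, 0)` and `Yᵢ = X (i, 1)`. -/
def tensorToBihom (d : ℕ) : (⨂[F] _ : ι, Forms F d) →ₗ[F] MvPolynomial (ι × Fin 2) F :=
  PiTensorProduct.lift
    ((MultilinearMap.mkPiAlgebra F ι (MvPolynomial (ι × Fin 2) F)).compLinearMap fun i =>
      (rename (Prod.mk i)).toLinearMap ∘ₗ (Forms F d).subtype)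

/-- Setting every `Yᵢ` to `1`. -/
def dehomogenize : MvPolynomial (ι × Fin 2) F →ₐ[F] MvPolynomial ι F :=
  aeval fun x => ![X x.1, 1] x.2

variable {F ι}

@[simp]
theorem tensorToBihom_tprod {d : ℕ} (P : ι → Forms F d) :
    tensorToBihom F ι d (PiTensorProduct.tprod F P) = ∏ i, rename (Prod.mk i) (P i).1 := by
  simp [tensorToBihom]

theorem tensorToPoly_eq {d : ℕ} (w : ⨂[F] _ : ι, Forms F d) :
    tensorToPoly F ι d w = dehomogenize F ι (tensorToBihom F ι d w) := by
  have : tensorToPoly F ι d = (dehomogenize F ι).toLinearMap ∘ₗ tensorToBihom F ι d := by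
    ext P
    simp only [tensorToPoly, LinearMap.compMultilinearMap_apply, PiTensorProduct.lift.tprod,
      LinearMap.comp_apply, tensorToBihom_tprod, AlgHom.toLinearMap_apply, map_prod,
      MultilinearMap.compLinearMap_apply, MultilinearMap.mkPiAlgebra_apply, dehomogenize,
      aeval_rename, Submodule.subtype_apply]
    rfl
  exact LinearMap.congr_fun this w

theorem tensorToPoly_tprod_binaryBasis {d : ℕ} (p : ι → Fin (d + 1)) :
    tensorToPoly F ι d (PiTensorProduct.tprod F fun i => binaryBasis F d (p i)) =
      monomial (Finsupp.equivFunOnFinite.symm fun i => (p i : ℕ)) 1 := by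
  rw [tensorToPoly_eq, tensorToBihom_tprod, map_prod, monomial_eq,
    Finsupp.prod_fintype _ _ (by simp)]
  simp [coe_binaryBasis, dehomogenize]

theorem tensorToPoly_injective (d : ℕ) : Function.Injective (tensorToPoly F ι d) := by
  classical
  let B := Basis.piTensorProduct fun _ : ι => binaryBasis F d
  have hcoeff : ∀ w p, coeff (Finsupp.equivFunOnFinite.symm fun i => ((p i : Fin (d + 1)) : ℕ))
      (tensorToPoly F ι d w) = B.repr w p := by
    intro w p
    have : lcoeff F (Finsupp.equivFunOnFinite.symm fun i => ((p i : Fin (d + 1)) : ℕ)) ∘ₗ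
        tensorToPoly F ι d = Finsupp.lapply p ∘ₗ B.repr.toLinearMap := by
      refine B.ext fun q => ?_
      simp only [LinearMap.comp_apply, LinearEquiv.coe_coe, Module.Basis.repr_self,
        Finsupp.lapply_apply, lcoeff_apply]
      simp only [B, Basis.piTensorProduct_apply]
      rw [tensorToPoly_tprod_binaryBasis, coeff_monomial, Finsupp.single_apply]
      congr 1
      rw [EmbeddingLike.apply_eq_iff_eq, eq_iff_iff, funext_iff, funext_iff]
      simp only [Fin.val_inj]
    exact LinearMap.congr_fun this w
  intro w w' h
  exact B.ext_elem fun p => by rw [← hcoeff, ← hcoeff, h]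

theorem tensorToBihom_injective (d : ℕ) : Function.Injective (tensorToBihom F ι d) :=
  fun w w' h => tensorToPoly_injective d (by rw [tensorToPoly_eq, tensorToPoly_eq, h])

theorem degreeOf_tensorToPoly_le {d : ℕ} (w : ⨂[F] _ : ι, Forms F d) (i : ι) :
    degreeOf i (tensorToPoly F ι d w) ≤ d := by
  classical
  rw [← (Basis.piTensorProduct fun _ : ι => binaryBasis F d).sum_repr w, map_sum]
  refine (degreeOf_sum_le _ _ _).trans (Finset.sup_le fun p _ => ?_)
  rw [map_smul, Basis.piTensorProduct_apply, tensorToPoly_tprod_binaryBasis, smul_monomial]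
  refine degreeOf_le_iff.2 fun m hm => ?_
  rw [Finset.mem_singleton.1 (support_monomial_subset hm)]
  simpa using Nat.lt_succ_iff.1 (p i).2

variable (F ι) in
/-- The action of a matrix on polynomials in the pairs of variables `(Xᵢ, Yᵢ)`, by simultaneous
linear substitution in every pair. -/
def pairSubst (A : Matrix (Fin 2) (Fin 2) F) :
    MvPolynomial (ι × Fin 2) F →ₐ[F] MvPolynomial (ι × Fin 2) F :=
  aeval fun x => ∑ k : Fin 2, C (A k x.2) * X (x.1, k)

theorem tensorToBihom_tensorRep {d : ℕ} (g : SL(2, F)) (w : ⨂[F] _ : ι, Forms F d) :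
    tensorToBihom F ι d (tensorRep ι (symUpper F d) g w) =
      pairSubst F ι g.1 (tensorToBihom F ι d w) := by
  have : tensorToBihom F ι d ∘ₗ tensorRep ι (symUpper F d) g =
      (pairSubst F ι g.1).toLinearMap ∘ₗ tensorToBihom F ι d := by
    ext P
    simp only [LinearMap.compMultilinearMap_apply, LinearMap.comp_apply]
    have h1 : tensorRep ι (symUpper F d) g (PiTensorProduct.tprod F P) =
        PiTensorProduct.tprod F fun i => symUpper F d g (P i) :=
      PiTensorProduct.map_tprod _ _
    rw [h1, tensorToBihom_tprod, tensorToBihom_tprod, AlgHom.toLinearMap_apply, map_prod]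
    congr 1
    refine Finset.prod_congr rfl fun i _ => ?_
    change rename (Prod.mk i) (substHom F g.1 (P i).1) = _
    rw [substHom, pairSubst, aeval_rename, ← AlgHom.comp_apply, comp_aeval]
    congr 2
    funext j
    simp
  exact LinearMap.congr_fun this w

theorem tensorToBihom_reindex {ι' : Type*} [Fintype ι'] {d : ℕ} (e : ι ≃ ι')
    (w : ⨂[F] _ : ι, Forms F d) :
    tensorToBihom F ι' d (PiTensorProduct.reindex F (fun _ => Forms F d) e w) =
      rename (Prod.map e id) (tensorToBihom F ι d w) := by
  have : tensorToBihom F ι' d ∘ₗ (PiTensorProduct.reindex F (fun _ => Forms F d) e).toLinearMap =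
      (rename (Prod.map e id)).toLinearMap ∘ₗ tensorToBihom F ι d := by
    ext P
    simp only [LinearMap.compMultilinearMap_apply, LinearMap.comp_apply, LinearEquiv.coe_coe]
    rw [PiTensorProduct.reindex_tprod, tensorToBihom_tprod, tensorToBihom_tprod,
      AlgHom.toLinearMap_apply, map_prod]
    congr 1
    symm
    refine Fintype.prod_equiv e _ _ fun i => ?_
    rw [rename_rename, Equiv.symm_apply_apply]
    rfl
  exact LinearMap.congr_fun this w

theorem tensorToBihom_tmulEquiv {ι' : Type*} [Fintype ι'] {d : ℕ}
    (w : ⨂[F] _ : ι, Forms F d) (w' : ⨂[F] _ : ι', Forms F d) :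
    tensorToBihom F (ι ⊕ ι') d (PiTensorProduct.tmulEquiv F (Forms F d) (w ⊗ₜ[F] w')) =
      rename (Prod.map Sum.inl id) (tensorToBihom F ι d w) *
        rename (Prod.map Sum.inr id) (tensorToBihom F ι' d w') := by
  induction w using PiTensorProduct.induction_on with
  | add x y hx hy => rw [TensorProduct.add_tmul, map_add, map_add, hx, hy, map_add, map_add,
      add_mul]
  | smul_tprod r P =>
    induction w' using PiTensorProduct.induction_on with
    | add x y hx hy => rw [TensorProduct.tmul_add, map_add, map_add, hx, hy, map_add, map_add,
        mul_add]
    | smul_tprod r' P' =>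
      rw [TensorProduct.smul_tmul_smul]
      simp only [map_smul, PiTensorProduct.tmulEquiv_apply, tensorToBihom_tprod,
        Fintype.prod_sum_type, Sum.elim_inl, Sum.elim_inr, map_prod, rename_rename,
        smul_mul_smul_comm]
      rfl

/-- Multiplication of binary forms. -/
def formMul {a b d : ℕ} (h : a + b = d) : Forms F a →ₗ[F] Forms F b →ₗ[F] Forms F d :=
  LinearMap.mk₂ F (fun P Q => ⟨P.1 * Q.1, by
      rw [← h]
      exact IsHomogeneous.mul P.2 Q.2⟩)
    (fun _ _ _ => Subtype.ext (add_mul _ _ _)) (fun _ _ _ => Subtype.ext (smul_mul_assoc _ _ _))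
    (fun _ _ _ => Subtype.ext (mul_add _ _ _)) (fun _ _ _ => Subtype.ext (mul_smul_comm _ _ _))

variable (F ι) in
/-- Factorwise multiplication of tensors of binary forms. -/
def tensorMul {a b d : ℕ} (h : a + b = d) : (⨂[F] _ : ι, Forms F a) →ₗ[F]
    (⨂[F] _ : ι, Forms F b) →ₗ[F] ⨂[F] _ : ι, Forms F d :=
  PiTensorProduct.map₂ fun _ => formMul h

theorem tensorToBihom_tensorMul {a b d : ℕ} (h : a + b = d) (w : ⨂[F] _ : ι, Forms F a)
    (w' : ⨂[F] _ : ι, Forms F b) :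
    tensorToBihom F ι d (tensorMul F ι h w w') =
      tensorToBihom F ι a w * tensorToBihom F ι b w' := by
  induction w using PiTensorProduct.induction_on with
  | add x y hx hy => simp only [map_add, LinearMap.add_apply, hx, hy, add_mul]
  | smul_tprod r P =>
    induction w' using PiTensorProduct.induction_on with
    | add x y hx hy => simp only [map_add, hx, hy, mul_add]
    | smul_tprod r' P' =>
      simp only [map_smul, LinearMap.smul_apply, tensorMul, PiTensorProduct.map₂_tprod_tprod,
        tensorToBihom_tprod, smul_mul_smul_comm, ← Finset.prod_mul_distrib, smul_smul, formMul,
        LinearMap.mk₂_apply, map_mul, mul_comm]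

theorem placePerm_tensorMul {a b d : ℕ} (h : a + b = d) (σ : Equiv.Perm ι)
    (w : ⨂[F] _ : ι, Forms F a) (w' : ⨂[F] _ : ι, Forms F b) :
    placePerm F (Forms F d) σ (tensorMul F ι h w w') =
      tensorMul F ι h (placePerm F (Forms F a) σ w) (placePerm F (Forms F b) σ w') := by
  apply tensorToBihom_injective
  rw [tensorToBihom_reindex, tensorToBihom_tensorMul, tensorToBihom_tensorMul,
    tensorToBihom_reindex, tensorToBihom_reindex, map_mul]

end PolynomialModel

/-! ### The map and its injectivity -/

section HookMultiplication

open MvPolynomial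

local notation "Forms" => MvPolynomial.homogeneousSubmodule (Fin 2)

variable (F : Type*) [Field F]

/-- The column tensor `X^n ∧ X^(n-1)Y ∧ ⋯ ∧ Y^n`, which spans the top exterior power of the
space of binary forms of degree `n`. -/
def vandermondeTensor (n : ℕ) : ⨂[F] _ : Fin (n + 1), Forms F n :=
  ∑ τ : Equiv.Perm (Fin (n + 1)), ((Equiv.Perm.sign τ : ℤ) : F) •
    PiTensorProduct.tprod F fun i => binaryBasis F n (Fin.rev (τ.symm i))

theorem tensorToBihom_vandermondeTensor (n : ℕ) :
    tensorToBihom F (Fin (n + 1)) n (vandermondeTensor F n) =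
      ∏ i : Fin (n + 1), ∏ j ∈ Finset.Ioi i, (X (j, 1) * X (i, 0) - X (i, 1) * X (j, 0)) := by
  rw [← Matrix.det_projVandermonde (fun i : Fin (n + 1) => (X (i, 1) : MvPolynomial _ F))
    (fun i => X (i, 0)), Matrix.det_apply, vandermondeTensor, map_sum]
  refine Finset.sum_congr rfl fun τ _ => ?_
  rw [map_smul, tensorToBihom_tprod, Units.smul_def, ← Int.cast_smul_eq_zsmul F]
  congr 1
  symm
  refine Fintype.prod_equiv τ _ _ fun i => ?_
  rw [Equiv.symm_apply_apply, coe_binaryBasis, Matrix.projVandermonde_apply]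
  have : n - (Fin.rev i).1 = i.1 := by
    rw [Fin.val_rev]
    omega
  rw [this]
  simp [mul_comm]

variable {F}

theorem pairSubst_vandermonde (n : ℕ) (g : SL(2, F)) :
    pairSubst F (Fin (n + 1)) g.1 (∏ i : Fin (n + 1), ∏ j ∈ Finset.Ioi i,
        (X (j, 1) * X (i, 0) - X (i, 1) * X (j, 0))) =
      ∏ i : Fin (n + 1), ∏ j ∈ Finset.Ioi i, (X (j, 1) * X (i, 0) - X (i, 1) * X (j, 0)) := by
  rw [map_prod]
  refine Finset.prod_congr rfl fun i _ => ?_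
  rw [map_prod]
  refine Finset.prod_congr rfl fun j _ => ?_
  have hdet : C (g.1 0 0) * C (g.1 1 1) - C (g.1 0 1) * C (g.1 1 0) =
      (1 : MvPolynomial (Fin (n + 1) × Fin 2) F) := by
    have := g.2
    rw [Matrix.det_fin_two] at this
    rw [← C_mul, ← C_mul, ← C_sub, this, C_1]
  simp only [pairSubst, map_sub, map_mul, aeval_X, Fin.sum_univ_two]
  linear_combination
    ((X (j, 1) : MvPolynomial (Fin (n + 1) × Fin 2) F) * X (i, 0) - X (i, 1) * X (j, 0)) * hdet

variable (F) in
/-- The bilinear map underlying the isomorphism: `s` and `t` are sent to the factorwise product of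
`(X^n ∧ ⋯ ∧ Y^n) ⊗ s` and `t`, the factors of `t` being placed in the hook by `e`. -/
def hookMul {M n k d m : ℕ} (h : n + k = d) (e : Fin m ≃ HookBox M n) :
    (⨂[F] _ : Fin M, Forms F n) →ₗ[F] (⨂[F] _ : Fin m, Forms F k) →ₗ[F]
      ⨂[F] _ : HookBox M n, Forms F d :=
  (tensorMul F (HookBox M n) h).compl₁₂
    ((PiTensorProduct.tmulEquiv F (Forms F n)).toLinearMap ∘ₗ
      TensorProduct.mk F _ _ (vandermondeTensor F n))
    (PiTensorProduct.reindex F (fun _ => Forms F k) e).toLinearMap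

section

variable {M n k d m : ℕ} (h : n + k = d)

theorem hookMul_apply (e : Fin m ≃ HookBox M n) (s : ⨂[F] _ : Fin M, Forms F n)
    (t : ⨂[F] _ : Fin m, Forms F k) : hookMul F h e s t =
      tensorMul F (HookBox M n) h
        (PiTensorProduct.tmulEquiv F (Forms F n) (vandermondeTensor F n ⊗ₜ[F] s))
        (PiTensorProduct.reindex F (fun _ => Forms F k) e t) := rfl

theorem tensorToBihom_hookMul (e : Fin m ≃ HookBox M n) (s : ⨂[F] _ : Fin M, Forms F n)
    (t : ⨂[F] _ : Fin m, Forms F k) :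
    tensorToBihom F _ d (hookMul F h e s t) =
      rename (Prod.map Sum.inl id) (∏ i : Fin (n + 1), ∏ j ∈ Finset.Ioi i,
          (X (j, 1) * X (i, 0) - X (i, 1) * X (j, 0))) *
        rename (Prod.map Sum.inr id) (tensorToBihom F _ n s) *
        rename (Prod.map e id) (tensorToBihom F _ k t) := by
  rw [hookMul_apply, tensorToBihom_tensorMul, tensorToBihom_tmulEquiv, tensorToBihom_reindex,
    tensorToBihom_vandermondeTensor]

theorem dehomogenize_rename {ι ι' : Type*} [Fintype ι] [Fintype ι'] (f : ι → ι')
    (p : MvPolynomial (ι × Fin 2) F) :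
    dehomogenize F ι' (rename (Prod.map f id) p) = rename f (dehomogenize F ι p) := by
  rw [dehomogenize, dehomogenize, aeval_rename, ← AlgHom.comp_apply, comp_aeval]
  congr 2
  funext ⟨i, j⟩
  fin_cases j <;> simp

theorem tensorToPoly_hookMul (e : Fin m ≃ HookBox M n) (s : ⨂[F] _ : Fin M, Forms F n)
    (t : ⨂[F] _ : Fin m, Forms F k) :
    tensorToPoly F _ d (hookMul F h e s t) =
      vandermondePoly F M n * (rename Sum.inr (tensorToPoly F _ n s) *
        rename e (tensorToPoly F _ k t)) := by
  rw [tensorToPoly_eq, tensorToBihom_hookMul, map_mul, map_mul, dehomogenize_rename,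
    dehomogenize_rename, dehomogenize_rename, ← tensorToPoly_eq, ← tensorToPoly_eq, mul_assoc]
  congr 1
  simp [vandermondePoly, dehomogenize, map_prod]

theorem pairSubst_rename {ι ι' : Type*} [Fintype ι] [Fintype ι'] (f : ι → ι')
    (A : Matrix (Fin 2) (Fin 2) F) (p : MvPolynomial (ι × Fin 2) F) :
    pairSubst F ι' A (rename (Prod.map f id) p) = rename (Prod.map f id) (pairSubst F ι A p) := by
  rw [pairSubst, pairSubst, aeval_rename, ← AlgHom.comp_apply, comp_aeval]
  congr 2
  funext ⟨i, j⟩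
  simp

/-- `SL₂`-equivariance: `Xᵢ Yⱼ - Xⱼ Yᵢ` is invariant under substitutions of determinant `1`. -/
theorem hookMul_tensorRep (e : Fin m ≃ HookBox M n) (g : SL(2, F))
    (s : ⨂[F] _ : Fin M, Forms F n) (t : ⨂[F] _ : Fin m, Forms F k) :
    hookMul F h e (tensorRep _ (symUpper F n) g s) (tensorRep _ (symUpper F k) g t) =
      tensorRep _ (symUpper F d) g (hookMul F h e s t) := by
  apply tensorToBihom_injective
  rw [tensorToBihom_tensorRep, tensorToBihom_hookMul, tensorToBihom_hookMul,
    tensorToBihom_tensorRep, tensorToBihom_tensorRep, map_mul, map_mul, pairSubst_rename,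
    pairSubst_rename, pairSubst_rename, pairSubst_vandermonde]

theorem rename_tensorToPoly {ι ι' : Type*} [Fintype ι] [Fintype ι'] {d : ℕ} (e : ι ≃ ι')
    (w : ⨂[F] _ : ι, Forms F d) :
    rename e (tensorToPoly F ι d w) =
      tensorToPoly F ι' d (PiTensorProduct.reindex F (fun _ => Forms F d) e w) := by
  rw [tensorToPoly_eq, tensorToPoly_eq, tensorToBihom_reindex, dehomogenize_rename]

theorem reindex_symLower {V : Type*} [AddCommGroup V] [Module F V] {ι : Type*}
    {t : ⨂[F] _ : Fin m, V} (ht : t ∈ symLowerSubmodule F V m) (e e' : Fin m ≃ ι) :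
    PiTensorProduct.reindex F (fun _ => V) e t = PiTensorProduct.reindex F (fun _ => V) e' t := by
  conv_rhs => rw [← ht (e.trans e'.symm)]
  refine Eq.trans ?_ (PiTensorProduct.reindex_reindex (e.trans e'.symm) e' t).symm
  rw [Equiv.trans_assoc, Equiv.symm_trans_self, Equiv.trans_refl]

/-- A symmetric tensor gives the same polynomial however its factors are matched with `ι`. -/
theorem rename_symLower {ι : Type*} [Fintype ι] {t : ⨂[F] _ : Fin m, Forms F k}
    (ht : t ∈ symLowerSubmodule F (Forms F k) m) (e e' : Fin m ≃ ι) :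
    rename e (tensorToPoly F _ k t) = rename e' (tensorToPoly F _ k t) := by
  rw [rename_tensorToPoly, rename_tensorToPoly, reindex_symLower ht e e']

end

section Injectivity

/-- Additive group structure recovered from the `F`-module structure: instance search does not find
`Submodule.addCommGroup` here, because it meets two forms of the additive structure on the space
of binary forms. -/
instance addCommGroupSymLower (k m : ℕ) : AddCommGroup (symLowerSubmodule F (Forms F k) m) :=
  Module.addCommMonoidToAddCommGroup F

/-- A polynomial of degree at most `n` in each of `m` variables is zero as soon as it vanishes at
all `m`-tuples of distinct elements of a set of `m + n` points. -/
theorem eq_zero_of_eval_injective {R α : Type*} [CommRing R] [IsDomain R] [Fintype α] {x : α → R}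
    (hx : Function.Injective x) (n : ℕ) :
    ∀ (m : ℕ) (P : MvPolynomial (Fin m) R), (∀ i, degreeOf i P ≤ n) → m + n ≤ Fintype.card α →
      (∀ q : Fin m → α, Function.Injective q → eval (x ∘ q) P = 0) → P = 0 := by
  classical
  intro m
  induction m with
  | zero =>
    intro P _ _ hP
    have h0 := hP Fin.elim0 (fun i => i.elim0)
    rw [eq_C_of_isEmpty P] at h0 ⊢
    rw [eval_C] at h0
    rw [h0, C_0]
  | succ m ih =>
    intro P hdeg hcard hP
    rw [← (MvPolynomial.finSuccEquiv R m).map_eq_zero_iff]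
    ext1 j
    rw [Polynomial.coeff_zero]
    refine ih _ (fun i => (degreeOf_coeff_finSuccEquiv P i j).trans (hdeg _)) (by omega)
      fun q hq => ?_
    -- With the other variables fixed at distinct points, more than `n` points are left for the
    -- first one.
    have hzero : (MvPolynomial.finSuccEquiv R m P).map (eval (x ∘ q)) = 0 := by
      refine Polynomial.eq_zero_of_natDegree_lt_card_of_eval_eq_zero' _
        (((Finset.univ.image q)ᶜ).image x) ?_ ?_
      · intro y hy
        obtain ⟨a, ha, rfl⟩ := Finset.mem_image.1 hy
        have ha' : ∀ i, a ≠ q i := fun i hi =>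
          (Finset.mem_compl.1 ha) (hi ▸ Finset.mem_image_of_mem q (Finset.mem_univ i))
        rw [← eval_eq_eval_mv_eval']
        have h1 := hP (Fin.cons a q) (Fin.cons_injective_iff.2
          ⟨fun ⟨i, hi⟩ => ha' i hi.symm, hq⟩)
        rwa [show x ∘ (Fin.cons a q : Fin (m + 1) → α) = Fin.cons (x a) (x ∘ q) from
          Fin.comp_cons x a q] at h1
      · rw [Finset.card_image_of_injective _ hx, Finset.card_compl,
          Finset.card_image_of_injective _ hq, Finset.card_univ, Fintype.card_fin]
        refine lt_of_le_of_lt (Polynomial.natDegree_map_le.trans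
          ((natDegree_finSuccEquiv P).le.trans (hdeg 0))) ?_
        omega
    have := congrArg (fun p => Polynomial.coeff p j) hzero
    simpa using this

theorem vandermondePoly_ne_zero (M n : ℕ) : vandermondePoly F M n ≠ 0 := by
  refine Finset.prod_ne_zero_iff.2 fun i _ => Finset.prod_ne_zero_iff.2 fun j hj => ?_
  rw [sub_ne_zero]
  intro hij
  exact (Finset.mem_Ioi.1 hj).ne (Sum.inl_injective (X_injective hij))

variable {M n k d m : ℕ} (h : n + k = d)

/-- The restriction of `hookMul` to symmetric tensors is injective. Symmetric polynomials `R` in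
all variables do not change when the row variables are moved to other boxes of the hook, so a
relation `∑ Q_α(y) R_α(x, y) = 0` persists when `y` is replaced by any `M` distinct variables out
of the `M + n + 1`; hence `∑ Q_α(T) R_α = 0` for indeterminates `T`. -/
theorem hookMul_injective (e : Fin m ≃ HookBox M n) : Function.Injective
    (TensorProduct.lift ((hookMul F h e).compl₁₂ (symLowerSubmodule F (Forms F n) M).subtype
      (symLowerSubmodule F (Forms F k) m).subtype)) := by
  classical
  let A := MvPolynomial (HookBox M n) F
  let f : symLowerSubmodule F (Forms F n) M →ₗ[F] MvPolynomial (Fin M) F :=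
    tensorToPoly F (Fin M) n ∘ₗ Submodule.subtype _
  let r : symLowerSubmodule F (Forms F k) m →ₗ[F] A :=
    (rename e).toLinearMap ∘ₗ tensorToPoly F (Fin m) k ∘ₗ Submodule.subtype _
  have hf : Function.Injective f := (tensorToPoly_injective n).comp Subtype.val_injective
  have hr : Function.Injective r := (rename_injective _ e.injective).comp
    ((tensorToPoly_injective k).comp Subtype.val_injective)
  let Θ : (symLowerSubmodule F (Forms F n) M) ⊗[F] (symLowerSubmodule F (Forms F k) m) →ₗ[F]
      MvPolynomial (Fin M) A :=
    ((algebraTensorAlgEquiv F A).toLinearMap.restrictScalars F) ∘ₗ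
      (TensorProduct.comm F _ _).toLinearMap ∘ₗ TensorProduct.map f r
  have hΘ : Function.Injective Θ := (algebraTensorAlgEquiv F A).injective.comp
    ((TensorProduct.comm F _ _).injective.comp (TensorProduct.map_injective_of_flat_flat f r hf hr))
  have hΘt : ∀ s t, Θ (s ⊗ₜ t) = C (r t) * map (algebraMap F A) (f s) := fun s t => by
    rw [← smul_eq_C_mul]
    exact algebraTensorAlgEquiv_tmul F A (r t) (f s)
  have heval : ∀ s t (q : Fin M → HookBox M n),
      eval (X ∘ q) (Θ (s ⊗ₜ t)) = r t * rename q (f s) := fun s t q => by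
    rw [hΘt, map_mul, eval_C, eval_map]
    have hq : rename q = (aeval (X ∘ q) : MvPolynomial (Fin M) F →ₐ[F] A) := by
      ext i
      simp [A]
    rw [hq, aeval_def]
  have hdeg : ∀ z i, degreeOf i (Θ z) ≤ n := by
    intro z i
    induction z using TensorProduct.induction_on with
    | zero => simp
    | add x y hx hy =>
      rw [map_add]
      exact (degreeOf_add_le _ _ _).trans (max_le hx hy)
    | tmul s t =>
      rw [hΘt]
      refine (degreeOf_C_mul_le _ _ _).trans (le_trans ?_ (degreeOf_tensorToPoly_le s.1 i))
      exact degreeOf_le_iff.2 fun a ha =>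
        degreeOf_le_iff.1 le_rfl a (support_map_subset _ _ ha)
  have hperm : ∀ z (π : Equiv.Perm (HookBox M n)),
      eval (X ∘ π ∘ Sum.inr) (Θ z) = rename π (eval (X ∘ Sum.inr) (Θ z)) := by
    intro z π
    induction z using TensorProduct.induction_on with
    | zero => simp
    | add x y hx hy => simp only [map_add, hx, hy]
    | tmul s t =>
      rw [heval, heval, map_mul, rename_rename]
      congr 1
      change rename e _ = rename π (rename e _)
      rw [rename_rename]
      exact rename_symLower t.2 e (e.trans π)
  have hΔ : ∀ z, tensorToPoly F _ d (TensorProduct.lift ((hookMul F h e).compl₁₂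
      (symLowerSubmodule F (Forms F n) M).subtype
      (symLowerSubmodule F (Forms F k) m).subtype) z) =
      vandermondePoly F M n * eval (X ∘ Sum.inr) (Θ z) := by
    intro z
    induction z using TensorProduct.induction_on with
    | zero => simp
    | add x y hx hy => simp only [map_add, hx, hy, mul_add]
    | tmul s t =>
      rw [heval, TensorProduct.lift.tmul, mul_comm (r t)]
      exact tensorToPoly_hookMul h e s.1 t.1
  rw [injective_iff_map_eq_zero]
  intro z hz
  have h0 : eval (X ∘ Sum.inr) (Θ z) = 0 := by
    have h1 := hΔ z
    rw [hz, map_zero] at h1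
    exact (mul_eq_zero.1 h1.symm).resolve_left (vandermondePoly_ne_zero M n)
  apply hΘ
  rw [map_zero]
  refine eq_zero_of_eval_injective (X_injective (σ := HookBox M n) (R := F)) n M _ (hdeg z)
    (by simp; omega) fun q hq => ?_
  let ε : {x : HookBox M n // x ∈ Set.range Sum.inr} ≃ {x : HookBox M n // x ∈ Set.range q} :=
    (Equiv.ofInjective Sum.inr Sum.inr_injective).symm.trans (Equiv.ofInjective q hq)
  have hq' : q = ε.extendSubtype ∘ Sum.inr := by
    funext j
    rw [Function.comp_apply, Equiv.extendSubtype_apply_of_mem ε _ ⟨j, rfl⟩]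
    have : (Equiv.ofInjective (Sum.inr : Fin M → HookBox M n) Sum.inr_injective).symm
        ⟨Sum.inr j, ⟨j, rfl⟩⟩ = j := Equiv.ofInjective_symm_apply Sum.inr_injective j
    simp only [ε, Equiv.trans_apply, this, Equiv.ofInjective_apply]
  rw [hq', hperm, h0, map_zero]

end Injectivity

end HookMultiplication

/-! ### The image of the map -/

section Image

open MvPolynomial

local notation "Forms" => MvPolynomial.homogeneousSubmodule (Fin 2)

variable {F : Type*} [Field F]

theorem columnAntisymm_tprod_eq_zero {V κ : Type*} [AddCommGroup V] [Module F V]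
    (v : Module.Basis κ F V) {M n : ℕ} (q : HookBox M n → κ) {i j : Fin (n + 1)} (hij : i ≠ j)
    (hq : q (Sum.inl i) = q (Sum.inl j)) :
    columnAntisymm F V M n (PiTensorProduct.tprod F fun x => v (q x)) = 0 := by
  classical
  let B := Basis.piTensorProduct fun _ : HookBox M n => v
  refine B.ext_elem fun p => ?_
  rw [repr_columnAntisymm, map_zero, Finsupp.zero_apply]
  refine sum_sign_mul_eq_zero _ hij fun τ => ?_
  have hB : (PiTensorProduct.tprod F fun x => v (q x)) = B q := by
    rw [Basis.piTensorProduct_apply]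
  rw [hB, Module.Basis.repr_self, Finsupp.single_apply, Finsupp.single_apply]
  congr 1
  have hsw : q ∘ Equiv.sumCongr (Equiv.swap i j) (Equiv.refl (Fin M)) = q := by
    funext x
    rcases x with x | x
    · simp only [Function.comp_apply, Equiv.sumCongr_apply, Sum.map_inl, Equiv.swap_apply_def]
      split_ifs with h1 h2
      · rw [h1, hq]
      · rw [h2, hq]
      · rfl
    · rfl
  have hmul : p ∘ Equiv.sumCongr (τ * Equiv.swap i j) (Equiv.refl (Fin M)) =
      (p ∘ Equiv.sumCongr τ (Equiv.refl (Fin M))) ∘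
        Equiv.sumCongr (Equiv.swap i j) (Equiv.refl (Fin M)) := by
    funext x
    rcases x with x | x <;> rfl
  rw [hmul, eq_iff_iff]
  constructor
  · intro h
    refine (Equiv.sumCongr (Equiv.swap i j) (Equiv.refl (Fin M))).surjective.injective_comp_right ?_
    exact hsw.trans h
  · intro h
    rw [← h, hsw]

/-- A symmetric function `c` on `M`-tuples extends to a symmetric function on `(M + 1)`-tuples
along insertion of a fixed element `a`. -/
theorem exists_symmetric_extension {κ R : Type*} [Zero R] {M : ℕ} (a : κ) (c : (Fin M → κ) → R)
    (hc : ∀ p q : Fin M → κ, (Finset.univ : Finset (Fin M)).val.map p =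
      (Finset.univ : Finset (Fin M)).val.map q → c p = c q) :
    ∃ G : (Fin (M + 1) → κ) → R, (∀ r (τ : Equiv.Perm (Fin (M + 1))), G (r ∘ τ) = G r) ∧
      ∀ p, G (Fin.cons a p) = c p := by
  classical
  let ex : Multiset κ → R := fun s =>
    if h : ∃ p : Fin M → κ, a ::ₘ (Finset.univ : Finset (Fin M)).val.map p = s
    then c h.choose else 0
  refine ⟨fun r => ex ((Finset.univ : Finset (Fin (M + 1))).val.map r), fun r τ => ?_, fun p => ?_⟩
  · beta_reduce
    rw [← Multiset.map_map, Multiset.map_univ_val_equiv]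
  · have hp : (Finset.univ : Finset (Fin (M + 1))).val.map (Fin.cons a p : Fin (M + 1) → κ) =
        a ::ₘ (Finset.univ : Finset (Fin M)).val.map p := by
      rw [Fin.univ_val_map, Fin.univ_val_map, List.ofFn_succ]
      simp
    have h : ∃ p' : Fin M → κ, a ::ₘ (Finset.univ : Finset (Fin M)).val.map p' =
        (Finset.univ : Finset (Fin (M + 1))).val.map (Fin.cons a p : Fin (M + 1) → κ) :=
      ⟨p, hp.symm⟩
    simp only [ex]
    rw [dif_pos h]
    exact hc _ _ ((Multiset.cons_inj_right a).1 (h.choose_spec.trans hp))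

/-- For `d = n`, the tensor `(X^n ∧ ⋯ ∧ Y^n) ⊗ s` comes from a row-symmetric tensor: extend the
coefficients of `s` symmetrically to the whole row, in such a way that `s` is recovered when the
corner contains `X^n`, and fill the rest of the column by `X^(n-1)Y, …, Y^n`. Any other corner entry
is then repeated in the column and killed by antisymmetrization. -/
theorem exists_rowSymmetric_columnAntisymm_eq {M n : ℕ} {s : ⨂[F] _ : Fin M, Forms F n}
    (hs : s ∈ symLowerSubmodule F (Forms F n) M) :
    ∃ f ∈ rowSymmetric F (Forms F n) M n, columnAntisymm F (Forms F n) M n f =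
      PiTensorProduct.tmulEquiv F (Forms F n) (vandermondeTensor F n ⊗ₜ[F] s) := by
  classical
  let v := binaryBasis F n
  let B := Basis.piTensorProduct fun _ : Fin M => v
  obtain ⟨G, hG, hGs⟩ := exists_symmetric_extension (Fin.last n) (fun p => B.repr s p)
    fun p q h => repr_symLower_congr v hs h
  let b : Fin n → Fin (n + 1) := fun i => Fin.rev i.succ
  let T : (Fin (M + 1) → Fin (n + 1)) → ⨂[F] _ : HookBox M n, Forms F n := fun r =>
    PiTensorProduct.tprod F fun x => v (hookFill r b x)
  refine ⟨∑ r, G r • T r, fun σ hσ => ?_, ?_⟩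
  · obtain ⟨τ, hτ⟩ := hookFill_rowPerm (κ := Fin (n + 1)) σ.symm
      (fun i hi => by rw [Equiv.symm_apply_eq, hσ i hi])
    simp only [map_sum, map_smul, T, placePerm_hookFill, hτ]
    refine Fintype.sum_equiv (Equiv.arrowCongr τ.symm (Equiv.refl _)) _ _ fun r => ?_
    have : (Equiv.arrowCongr τ.symm (Equiv.refl _)) r = r ∘ τ := rfl
    rw [this, hG]
  · have hlast : ∀ p : Fin M → Fin (n + 1),
        columnAntisymm F (Forms F n) M n (T (Fin.cons (Fin.last n) p)) =
          PiTensorProduct.tmulEquiv F (Forms F n) (vandermondeTensor F n ⊗ₜ[F] B p) := by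
      intro p
      rw [vandermondeTensor, TensorProduct.sum_tmul, map_sum, columnAntisymm, LinearMap.sum_apply]
      refine Finset.sum_congr rfl fun τ _ => ?_
      rw [LinearMap.smul_apply, ← TensorProduct.smul_tmul', map_smul, Basis.piTensorProduct_apply,
        PiTensorProduct.tmulEquiv_apply]
      congr 1
      refine (PiTensorProduct.reindex_tprod _ _).trans ?_
      congr 1
      funext x
      rcases x with x | x
      · change v (hookFill _ b (Sum.inl (τ.symm x))) = v (Fin.rev (τ.symm x))
        congr 1
        refine Fin.cases ?_ (fun j => ?_) (τ.symm x) <;> simp [hookFill, b]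
      · change v (hookFill _ b (Sum.inr x)) = v (p x)
        simp [hookFill]
    have hother : ∀ (k : Fin (n + 1)) (p : Fin M → Fin (n + 1)), k ≠ Fin.last n →
        columnAntisymm F (Forms F n) M n (T (Fin.cons k p)) = 0 := by
      intro k p hk
      have hk' : Fin.rev k ≠ 0 := fun h => hk (by rw [← Fin.rev_rev k, h, Fin.rev_zero])
      obtain ⟨i, hi⟩ := Fin.exists_succ_eq.2 hk'
      refine columnAntisymm_tprod_eq_zero v _ (Fin.succ_ne_zero i).symm ?_
      simp only [hookFill, Sum.elim_inl, Fin.cons_zero, Fin.cons_succ, b]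
      rw [hi, Fin.rev_rev]
    simp only [map_sum, map_smul]
    rw [← (Fin.consEquiv fun _ => Fin (n + 1)).sum_comp, Fintype.sum_prod_type,
      Finset.sum_eq_single (Fin.last n)]
    · conv_rhs => rw [← B.sum_repr s]
      rw [TensorProduct.tmul_sum, map_sum]
      refine Finset.sum_congr rfl fun p _ => ?_
      change G (Fin.cons (Fin.last n) p) • columnAntisymm F (Forms F n) M n
        (T (Fin.cons (Fin.last n) p)) = _
      rw [hlast, hGs, TensorProduct.tmul_smul, map_smul]
    · intro k _ hk
      refine Finset.sum_eq_zero fun p _ => ?_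
      change G (Fin.cons k p) • columnAntisymm F (Forms F n) M n (T (Fin.cons k p)) = _
      rw [hother k p hk, smul_zero]
    · simp

variable {M n k d m : ℕ} (h : n + k = d)

/-- Multiplication by a tensor that is invariant under all place permutations commutes with
antisymmetrization of the column and preserves row-symmetry. -/
theorem hookMul_mem_weylHookSubmodule (e : Fin m ≃ HookBox M n) {s : ⨂[F] _ : Fin M, Forms F n}
    (hs : s ∈ symLowerSubmodule F (Forms F n) M) {t : ⨂[F] _ : Fin m, Forms F k}
    (ht : t ∈ symLowerSubmodule F (Forms F k) m) :
    hookMul F h e s t ∈ weylHookSubmodule F (Forms F d) M n := by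
  have ht' : ∀ σ : Equiv.Perm (HookBox M n),
      placePerm F (Forms F k) σ (PiTensorProduct.reindex F (fun _ => Forms F k) e t) =
        PiTensorProduct.reindex F (fun _ => Forms F k) e t := fun σ =>
    (PiTensorProduct.reindex_reindex e σ t).trans (reindex_symLower ht _ _)
  obtain ⟨f, hf, hfs⟩ := exists_rowSymmetric_columnAntisymm_eq hs
  refine ⟨tensorMul F (HookBox M n) h f (PiTensorProduct.reindex F (fun _ => Forms F k) e t),
    fun σ hσ => by rw [placePerm_tensorMul, hf σ hσ, ht'], ?_⟩
  rw [hookMul_apply, ← hfs, columnAntisymm, columnAntisymm, LinearMap.sum_apply,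
    LinearMap.sum_apply, map_sum, LinearMap.sum_apply]
  refine Finset.sum_congr rfl fun τ _ => ?_
  rw [LinearMap.smul_apply, LinearMap.smul_apply, map_smul, LinearMap.smul_apply]
  congr 1
  refine (placePerm_tensorMul h _ _ _).trans ?_
  rw [ht']
  rfl

/-- As for `addCommGroupSymLower`. -/
instance addCommGroupWeylHook (M n d : ℕ) : AddCommGroup (weylHookSubmodule F (Forms F d) M n) :=
  Module.addCommMonoidToAddCommGroup F

theorem exists_hook_equiv {M n k d m : ℕ} (h : n + k = d) (hm : m = M + n + 1) :
    ∃ Φ : ((symLower M (symUpper F n)).tprod (symLower m (symUpper F k))).Equiv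
        (weylHook M n (symUpper F d)),
      ∀ (s : symLowerSubmodule F (Forms F n) M) (t : symLowerSubmodule F (Forms F k) m)
        (e : Fin m ≃ HookBox M n),
        tensorToPoly F (HookBox M n) d (Φ (s ⊗ₜ[F] t)).1 =
          vandermondePoly F M n * (rename Sum.inr (tensorToPoly F (Fin M) n s.1) *
            rename e (tensorToPoly F (Fin m) k t.1)) := by
  have e₀ : Fin m ≃ HookBox M n := Fintype.equivOfCardEq (by simp; omega)
  let φ := TensorProduct.lift ((hookMul F h e₀).compl₁₂
    (symLowerSubmodule F (Forms F n) M).subtype (symLowerSubmodule F (Forms F k) m).subtype)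
  have hφ : ∀ s t, φ (s ⊗ₜ t) = hookMul F h e₀ s.1 t.1 := fun s t => TensorProduct.lift.tmul s t
  have hmem : ∀ z, φ z ∈ weylHookSubmodule F (Forms F d) M n := by
    intro z
    induction z using TensorProduct.induction_on with
    | zero => simp
    | add x y hx hy =>
      rw [map_add]
      exact Submodule.add_mem _ hx hy
    | tmul s t =>
      rw [hφ]
      exact hookMul_mem_weylHookSubmodule h e₀ s.2 t.2
  have hinj : Function.Injective (φ.codRestrict _ hmem) := fun x y hxy =>
    hookMul_injective h e₀ (congrArg Subtype.val hxy)
  have hfin : ∀ j, Module.Finite F (Forms F j) := fun j =>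
    Module.Finite.of_basis (binaryBasis F j)
  have hfW := finite_weylHookSubmodule F (Forms F d) M n
  have hfn := finite_symLowerSubmodule F (Forms F n) M
  have hfk := finite_symLowerSubmodule F (Forms F k) m
  have hrank : Module.finrank F
      ((symLowerSubmodule F (Forms F n) M) ⊗[F] (symLowerSubmodule F (Forms F k) m)) =
      Module.finrank F (weylHookSubmodule F (Forms F d) M n) := by
    refine le_antisymm (LinearMap.finrank_le_finrank_of_injective hinj) ?_
    rw [Module.finrank_tensorProduct, hm]
    exact finrank_weylHook_le_mul M n k d h (binaryBasis F d) (binaryBasis F n) (binaryBasis F k)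
  let Φ := LinearEquiv.ofBijective _ ⟨hinj,
    (LinearMap.injective_iff_surjective_of_finrank_eq_finrank hrank).1 hinj⟩
  have hΦ : ∀ s t, (Φ (s ⊗ₜ t)).1 = hookMul F h e₀ s.1 t.1 := hφ
  refine ⟨Representation.Equiv.mk Φ fun g => ?_, fun s t e => ?_⟩
  · refine TensorProduct.ext' fun s t => Subtype.ext ?_
    refine (hΦ _ _).trans ((hookMul_tensorRep h e₀ g s.1 t.1).trans ?_)
    rw [← hΦ]
    rfl
  · refine (congrArg _ (hΦ s t)).trans ((tensorToPoly_hookMul h e₀ s.1 t.1).trans ?_)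
    rw [rename_symLower t.2 e₀ e]

end Image

end

end HookPlethysm

open HookPlethysm
theorem theorem1p1 {F : Type*} [Field F] (M d N : ℕ) (hN : 1 ≤ N) (hNd : N ≤ d + 1) :
    ∃ Φ : ((symLower M (symUpper F (N - 1))).tprod
        (symLower (M + N) (symUpper F (d + 1 - N)))).Equiv
        (weylHook M (N - 1) (symUpper F d)),
      ∀ (s : symLowerSubmodule F (MvPolynomial.homogeneousSubmodule (Fin 2) F (N - 1)) M)
        (t : symLowerSubmodule F (MvPolynomial.homogeneousSubmodule (Fin 2) F (d + 1 - N)) (M + N))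
        (e : Fin (M + N) ≃ HookBox M (N - 1)),
        tensorToPoly F (HookBox M (N - 1)) d (Φ (s ⊗ₜ[F] t)).1 =
          vandermondePoly F M (N - 1) *
            (MvPolynomial.rename Sum.inr (tensorToPoly F (Fin M) (N - 1) s.1) *
              MvPolynomial.rename e (tensorToPoly F (Fin (M + N)) (d + 1 - N) t.1)) :=
  exists_hook_equiv (by omega) (by omega)
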